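/- Write $e(x)=e^{2\pi i x}$. For integers $v_1,v_{12}\ge 1$ and $n_1,n_2$ put $$R_{v_1,v_{12}}(n_1,n_2)=\sum e\Big(\frac{n_1v_2}{v_1}+\frac{n_2v_{14}}{v_{12}}\Big),$$ where the sum runs over $v_2,v_3$ in $\{0,\dots,v_1-1\}$ and $v_{13},v_{14}$ in $\{0,\dots,v_{12}-1\}$ for which there are (necessarily unique) integers $v_4,v_{23},v_{34}$ with $$v_1v_{13}+v_2v_{14}-v_4v_{12}=0,\qquad v_1v_{23}=v_2v_{13}-v_3v_{12},\qquad v_1v_{34}=v_3v_{14}-v_4v_{13},$$ $$\gcd(v_1,v_2,v_3,v_4)=1,\qquad \gcd(v_{12},v_{13},v_{14},v_{23},v_{34})=1.$$ The generalised $\operatorname{Sp}(4,\mathbb Z)$ Ramanujan sum is the double Dirichlet series $$\mathcal R_{\nu_1,\nu_2}(n_1,n_2)=\sum_{v_1,v_{12}\ge 1}v_1^{-\nu_1}v_{12}^{-\nu_2}R_{v_1,v_{12}}(n_1,n_2)\qquad(\nu_1,\nu_2\in\mathbb C).$$ For integers $\lambda_1\ge\lambda_2\ge 0$ let $$\operatorname{Sp}_{\lambda_1,\lambda_2}(x_1,x_2)=\frac{\begin{vmatrix}x_1^{\lambda_1+2}-x_1^{-(\lambda_1+2)}&x_2^{\lambda_1+2}-x_2^{-(\lambda_1+2)}\\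 x_1^{\lambda_2+1}-x_1^{-(\lambda_2+1)}&x_2^{\lambda_2+1}-x_2^{-(\lambda_2+1)}\end{vmatrix}}{\begin{vmatrix}x_1^2-x_1^{-2}&x_2^2-x_2^{-2}\\ x_1-x_1^{-1}&x_2-x_2^{-1}\end{vmatrix}},$$ and for nonzero integers $n_1,n_2$ let $\sigma_{s_1,s_2}(n_1,n_2)=\prod_{p\mid n_1n_2}\sigma_{s_1,s_2}(p^{\operatorname{ord}_p n_1},p^{\operatorname{ord}_p n_2})$, where $$\sigma_{s_1,s_2}(p^{e_1},p^{e_2})=p^{(e_1+e_2)s_1+e_1s_2}\operatorname{Sp}_{e_1+e_2,\,e_1}(p^{s_1},p^{s_2}).$$ Let $\sigma_s(n)=\sum_{d\mid n,\,d\ge 1}d^s$ for a nonzero integer $n$, and let $Z=\zeta(\nu_1)\zeta(\nu_2)\zeta(\nu_1+\nu_2-1)\zeta(\nu_1+2\nu_2-2)$. **Proposition.** In each of the following cases the double series $\mathcal R_{\nu_1,\nu_2}(n_1,n_2)$ converges absolutely, as a series over the pairs $(v_1,v_{12})$, and has the stated value. 1. If $n_1\ne 0$, $n_2\neq 0$,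 $\operatorname{Re}\nu_1>1$ and $\operatorname{Re}\nu_2>1$: $$\mathcal R_{\nu_1,\nu_2}(n_1,n_2)=\frac{\sigma_{\frac32-\frac{\nu_1}2-\nu_2,\ \frac12-\frac{\nu_1}2}(n_1,n_2)}{Z}.$$ 2. If $n_1\ne 0$, $n_2=0$, $\operatorname{Re}\nu_1>1$ and $\operatorname{Re}\nu_2>2$: $$\mathcal R_{\nu_1,\nu_2}(n_1,0)=\frac{\sigma_{1-\nu_1}(n_1)\,\zeta(\nu_2-1)\,\zeta(\nu_1+\nu_2-2)\,\zeta(\nu_1+2\nu_2-3)}{Z}.$$ 3. If $n_1=0$, $n_2\ne 0$, $\operatorname{Re}\nu_1>2$ and $\operatorname{Re}\nu_2>1$: $$\mathcal R_{\nu_1,\nu_2}(0,n_2)=\frac{\sigma_{1-\nu_2}(n_2)\,\zeta(\nu_1-1)\,\zeta(\nu_1+\nu_2-2)\,\zeta(\nu_1+2\nu_2-3)}{Z}.$$ 4. If $n_1=n_2=0$, $\operatorname{Re}\nu_1>2$ and $\operatorname{Re}\nu_2>2$: $$\mathcal R_{\nu_1,\nu_2}(0,0)=\frac{\zeta(\nu_1-1)\,\zeta(\nu_2-1)\,\zeta(\nu_1+\nu_2-2)\,\zeta(\nu_1+2\nu_2-3)}{Z}.$$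 -/

import Mathlib

namespace SpRamanujan

noncomputable section

/-- Integers `v₁,…,v₃₄` (with `v₂₄ = -v₁₃` by symplecticity) are the Plücker coordinates of a coset
in the big Bruhat cell of `Sp(4, ℤ)`: they satisfy the Plücker relations through which `v₄`, `v₂₃`,
`v₃₄` are determined by the other coordinates, and both coordinate vectors are primitive. -/
def IsPlucker (v₁ v₂ v₃ v₄ v₁₂ v₁₃ v₁₄ v₂₃ v₃₄ : ℤ) : Prop :=
  v₁ * v₁₃ + v₂ * v₁₄ - v₄ * v₁₂ = 0 ∧
  v₁ * v₂₃ = v₂ * v₁₃ - v₃ * v₁₂ ∧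
  v₁ * v₃₄ = v₃ * v₁₄ - v₄ * v₁₃ ∧
  Int.gcd v₁ (Int.gcd v₂ (Int.gcd v₃ v₄)) = 1 ∧
  Int.gcd v₁₂ (Int.gcd v₁₃ (Int.gcd v₁₄ (Int.gcd v₂₃ v₃₄))) = 1

/-- The additive character `e(x) = exp(2πix)`. -/
def e (x : ℂ) : ℂ := Complex.exp (2 * Real.pi * Complex.I * x)

open Classical in
/-- The tuples `(v₂, v₃, v₁₃, v₁₄)` with `v₂, v₃` modulo `v₁` and `v₁₃, v₁₄` modulo `v₁₂` that are
completed by (necessarily unique) integers `v₄`, `v₂₃`, `v₃₄` to Plücker coordinates. The equation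
`v₁v₁₃ + v₂v₁₄ - v₄v₁₂ = 0` makes moving `v₄` by `v₁` the same as moving `v₁₃` by `v₁₂`,
so once `v₁₃` is taken from a fixed system of residues, `v₄` is an integer and not a residue. -/
def pluckerReps (v₁ v₁₂ : ℕ) : Finset (ℕ × ℕ × ℕ × ℕ) :=
  (Finset.range v₁ ×ˢ Finset.range v₁ ×ˢ Finset.range v₁₂ ×ˢ Finset.range v₁₂).filter
    fun (v₂, v₃, v₁₃, v₁₄) => ∃ v₄ v₂₃ v₃₄ : ℤ, IsPlucker v₁ v₂ v₃ v₄ v₁₂ v₁₃ v₁₄ v₂₃ v₃₄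

/-- The exponential sum `R_{v₁, v₁₂}(n₁, n₂)`. -/
def expSum (v₁ v₁₂ : ℕ) (n₁ n₂ : ℤ) : ℂ :=
  ∑ v ∈ pluckerReps v₁ v₁₂, e (n₁ * v.1 / v₁ + n₂ * v.2.2.2 / v₁₂)

/-- The term of index `(v₁, v₁₂)` of the double Dirichlet series. -/
def dirichletTerm (ν₁ ν₂ : ℂ) (n₁ n₂ : ℤ) (v : ℕ+ × ℕ+) : ℂ :=
  ((v.1 : ℕ) : ℂ) ^ (-ν₁) * ((v.2 : ℕ) : ℂ) ^ (-ν₂) * expSum v.1 v.2 n₁ n₂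

/-- The generalised Ramanujan sum `𝓡_{ν₁, ν₂}(n₁, n₂)`. -/
def ramanujan (ν₁ ν₂ : ℂ) (n₁ n₂ : ℤ) : ℂ :=
  ∑' v : ℕ+ × ℕ+, dirichletTerm ν₁ ν₂ n₁ n₂ v

/-- The symplectic Schur function `Sp_{l₁, l₂}(x₁, x₂)` of `Sp₄(ℂ)`, as a quotient of
determinants. -/
def symplecticSchur (l₁ l₂ : ℕ) (x₁ x₂ : ℂ) : ℂ :=
  Matrix.det !![x₁ ^ (l₁ + 2) - (x₁ ^ (l₁ + 2))⁻¹, x₂ ^ (l₁ + 2) - (x₂ ^ (l₁ + 2))⁻¹;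
                x₁ ^ (l₂ + 1) - (x₁ ^ (l₂ + 1))⁻¹, x₂ ^ (l₂ + 1) - (x₂ ^ (l₂ + 1))⁻¹] /
  Matrix.det !![x₁ ^ 2 - (x₁ ^ 2)⁻¹, x₂ ^ 2 - (x₂ ^ 2)⁻¹;
                x₁ - x₁⁻¹, x₂ - x₂⁻¹]

/-- The value `σ_{s₁, s₂}(p^{e₁}, p^{e₂})`. -/
def sigmaLocal (s₁ s₂ : ℂ) (p e₁ e₂ : ℕ) : ℂ :=
  (p : ℂ) ^ (((e₁ : ℂ) + e₂) * s₁ + e₁ * s₂) *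
    symplecticSchur (e₁ + e₂) e₁ ((p : ℂ) ^ s₁) ((p : ℂ) ^ s₂)

/-- The multiplicative function `σ_{s₁, s₂}(n₁, n₂)`, for nonzero integers `n₁, n₂`: the product of
its values at the `p`-parts. -/
def sigmaTwo (s₁ s₂ : ℂ) (n₁ n₂ : ℤ) : ℂ :=
  ∏ p ∈ (n₁ * n₂).natAbs.primeFactors, sigmaLocal s₁ s₂ p (padicValInt p n₁) (padicValInt p n₂)

/-- The classical divisor sum `σ_s(n) = ∑_{d ∣ n, d ≥ 1} d^s`, for a nonzero integer `n`. -/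
def sigmaOne (s : ℂ) (n : ℤ) : ℂ :=
  ∑ d ∈ n.natAbs.divisors, (d : ℂ) ^ s

/-- The common denominator `ζ(ν₁) ζ(ν₂) ζ(ν₁ + ν₂ - 1) ζ(ν₁ + 2ν₂ - 2)`. -/
def zetaDenom (ν₁ ν₂ : ℂ) : ℂ :=
  riemannZeta ν₁ * riemannZeta ν₂ * riemannZeta (ν₁ + ν₂ - 1) * riemannZeta (ν₁ + 2 * ν₂ - 2)

end

end SpRamanujan

namespace SpRamanujan

open Finset

noncomputable section

/-! The Plücker relations say that the vector `(v₁, v₂, v₃, v₄)` lies in the plane with Plücker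
coordinates `v₁₂, v₁₃, v₁₄, v₂₃, v₂₄ = -v₁₃, v₃₄`. Each of the four zeta factors of the denominator
simplifies the count of such flags, so the series is multiplied by them one at a time.

The factors `ζ(ν₁)` and `ζ(ν₂)` remove the two primitivity conditions (`powConv_expSum`). The factor
`ζ(ν₁ + ν₂ - 1)` weights a flag by `σ₁` of the gcd of its two contents, which is the number of
rank-two lattices with the given Plücker vector that contain the given vector (`powConv_boxSum`,
`sum_divisors_content`). Such a lattice has a Hermite basis `(A, f, *, *)`, `(0, D, *, *)` with `AD
= v₁₂`. Once it is fixed, the other coordinates run through linear congruences and the exponential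
sum can be evaluated (`sum_box_sublattice`). What remains depends on `f` through `gcd(f, A, D)`. The
factor `ζ(ν₁ + 2ν₂ - 2)` adds up the scalings of `(A, f; 0, D)` and turns this dependence into a
divisor sum (`sum_lineSum_denomWeight`), after which the sum over `f` is elementary.

The outcome is a series over quadruples `(c, A, D, α)` of monomials restricted by one divisibility
condition for each of `n₁`, `n₂` (`quadTerm`). A condition for `n = 0` is void. With both void the
series is a product of four zeta values; with one void, an involution on triples makes the remaining
condition involve a single variable (`hasSum_triple`). For nonzero `n₁`, `n₂` only finitely many
terms survive, their sum is multiplicative, and at prime powers it is a sum of geometric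
progressions equal to the Weyl quotient defining the symplectic Schur function (`localSum_eq`,
`symplecticSchur_eq`).

Convergence is transported the other way: the quadruple series converges absolutely, and convolution
with the Möbius function undoes each zeta factor (`summable_and_tsum_powConv`). -/

/-! ### Convolutions that multiply a double Dirichlet series by a zeta value -/

/-- The `d` with `d ^ i ∣ a` and `d ^ j ∣ b`. -/
def commonPowDivisors (i j a b : ℕ) : Finset ℕ :=
  (a * b).divisors.filter fun d => d ^ i ∣ a ∧ d ^ j ∣ b

theorem mem_commonPowDivisors {i j a b d : ℕ} (hij : i ≠ 0 ∨ j ≠ 0) (ha : a ≠ 0) (hb : b ≠ 0) :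
    d ∈ commonPowDivisors i j a b ↔ d ^ i ∣ a ∧ d ^ j ∣ b := by
  simp only [commonPowDivisors, mem_filter, Nat.mem_divisors, and_iff_right_iff_imp]
  rintro ⟨h1, h2⟩
  refine ⟨?_, mul_ne_zero ha hb⟩
  rcases hij with h | h
  · exact ((dvd_pow_self d h).trans h1).mul_right b
  · exact ((dvd_pow_self d h).trans h2).mul_left a

/-- Dirichlet convolution along the one-parameter family `d ↦ (d ^ i, d ^ j)`. -/
def powConv (i j : ℕ) (ψ : ℕ → ℂ) (f : ℕ → ℕ → ℂ) (a b : ℕ) : ℂ :=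
  ∑ d ∈ commonPowDivisors i j a b, ψ d * f (a / d ^ i) (b / d ^ j)

theorem powConv_congr {i j : ℕ} (hij : i ≠ 0 ∨ j ≠ 0) {ψ : ℕ → ℂ} {f g : ℕ → ℕ → ℂ}
    (h : ∀ a b, a ≠ 0 → b ≠ 0 → f a b = g a b) {a b : ℕ} (ha : a ≠ 0) (hb : b ≠ 0) :
    powConv i j ψ f a b = powConv i j ψ g a b := by
  refine sum_congr rfl fun d hd => ?_
  rw [mem_commonPowDivisors hij ha hb] at hd
  rw [h]
  · exact (Nat.div_pos (Nat.le_of_dvd ha.bot_lt hd.1) (Nat.pos_of_dvd_of_pos hd.1 ha.bot_lt)).ne'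
  · exact (Nat.div_pos (Nat.le_of_dvd hb.bot_lt hd.2) (Nat.pos_of_dvd_of_pos hd.2 hb.bot_lt)).ne'

/-- Since `d ↦ d ^ t` is completely multiplicative, grouping by the product `m` of the two
convolution variables leaves the inner factor `∑_{d ∣ m} μ(d)`, which vanishes unless `m = 1`. -/
theorem powConv_moebius {i j : ℕ} (hij : i ≠ 0 ∨ j ≠ 0) (t : ℕ) (f : ℕ → ℕ → ℂ) {a b : ℕ}
    (ha : a ≠ 0) (hb : b ≠ 0) :
    powConv i j (fun d => ArithmeticFunction.moebius d * (d : ℂ) ^ t)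
      (powConv i j (fun d => (d : ℂ) ^ t) f) a b = f a b := by
  have key : powConv i j (fun d => ArithmeticFunction.moebius d * (d : ℂ) ^ t)
      (powConv i j (fun d => (d : ℂ) ^ t) f) a b =
      ∑ m ∈ commonPowDivisors i j a b, ∑ d ∈ m.divisors,
        ArithmeticFunction.moebius d * ((m : ℂ) ^ t * f (a / m ^ i) (b / m ^ j)) := by
    unfold powConv
    simp_rw [mul_sum]
    rw [sum_sigma', sum_sigma']
    refine sum_bij' (fun q _ => ⟨q.1 * q.2, q.1⟩) (fun q _ => ⟨q.2, q.1 / q.2⟩) ?_ ?_ ?_ ?_ ?_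
    · rintro ⟨d, e⟩ h
      simp only [mem_sigma] at h ⊢
      obtain ⟨h1, h2⟩ := h
      rw [mem_commonPowDivisors hij ha hb] at h1
      obtain ⟨⟨a', rfl⟩, ⟨b', rfl⟩⟩ := h1
      have hd1 := (mul_ne_zero_iff.1 ha)
      have hd2 := (mul_ne_zero_iff.1 hb)
      rw [Nat.mul_div_cancel_left _ hd1.1.bot_lt, Nat.mul_div_cancel_left _ hd2.1.bot_lt,
        mem_commonPowDivisors hij hd1.2 hd2.2] at h2
      rw [mem_commonPowDivisors hij ha hb, mul_pow, mul_pow]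
      refine ⟨⟨mul_dvd_mul_left _ h2.1, mul_dvd_mul_left _ h2.2⟩, ?_⟩
      simp only [Nat.mem_divisors, dvd_mul_right, true_and]
      rcases hij with h | h
      · exact mul_ne_zero (fun h0 => hd1.1 (by rw [h0, zero_pow h]))
          (fun h0 => hd1.2 (by have := h2.1; rwa [h0, zero_pow h, zero_dvd_iff] at this))
      · exact mul_ne_zero (fun h0 => hd2.1 (by rw [h0, zero_pow h]))
          (fun h0 => hd2.2 (by have := h2.2; rwa [h0, zero_pow h, zero_dvd_iff] at this))
    · rintro ⟨m, d⟩ h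
      simp only [mem_sigma, Nat.mem_divisors] at h ⊢
      obtain ⟨h1, ⟨e, rfl⟩, h3⟩ := h
      rw [mem_commonPowDivisors hij ha hb, mul_pow, mul_pow] at h1
      obtain ⟨⟨a', rfl⟩, ⟨b', rfl⟩⟩ := h1
      rw [Nat.mul_div_cancel_left _ (mul_ne_zero_iff.1 h3).1.bot_lt, mul_assoc, mul_assoc]
      rw [mul_assoc] at ha hb
      have hd1 := (mul_ne_zero_iff.1 ha)
      have hd2 := (mul_ne_zero_iff.1 hb)
      rw [Nat.mul_div_cancel_left _ hd1.1.bot_lt, Nat.mul_div_cancel_left _ hd2.1.bot_lt,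
        mem_commonPowDivisors hij hd1.2 hd2.2, mem_commonPowDivisors hij ha hb]
      simp
    · rintro ⟨d, e⟩ h
      simp only [mem_sigma] at h
      rw [mem_commonPowDivisors hij ha hb] at h
      have hd : d ≠ 0 := by
        rintro rfl
        rcases hij with h' | h'
        · exact ha (by simpa [zero_pow h'] using h.1.1)
        · exact hb (by simpa [zero_pow h'] using h.1.2)
      simp [Nat.mul_div_cancel_left _ hd.bot_lt]
    · rintro ⟨m, d⟩ h
      simp only [mem_sigma, Nat.mem_divisors] at h
      simp [Nat.mul_div_cancel' h.2.1]
    · rintro ⟨d, e⟩ h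
      simp only [Nat.div_div_eq_div_mul, mul_pow, Nat.cast_mul]
      ring
  rw [key]
  simp_rw [← sum_mul]
  have h1 : ∀ m : ℕ, (∑ d ∈ m.divisors, (ArithmeticFunction.moebius d : ℂ)) =
      if m = 1 then 1 else 0 := by
    intro m
    have := congrArg (fun F : ArithmeticFunction ℤ => F m)
      ArithmeticFunction.coe_zeta_mul_moebius
    simp only [ArithmeticFunction.coe_zeta_mul_apply, ArithmeticFunction.one_apply] at this
    exact_mod_cast this
  simp_rw [h1, ite_mul, one_mul, zero_mul]
  rw [sum_ite_eq' _ 1 (fun m : ℕ => (m : ℂ) ^ t * f (a / m ^ i) (b / m ^ j))]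
  simp [mem_commonPowDivisors hij ha hb]

/-- The term of index `(a, b)` of the double Dirichlet series with coefficients `f`. -/
def dirichletWeight (ν₁ ν₂ : ℂ) (f : ℕ → ℕ → ℂ) (v : ℕ+ × ℕ+) : ℂ :=
  ((v.1 : ℕ) : ℂ) ^ (-ν₁) * ((v.2 : ℕ) : ℂ) ^ (-ν₂) * f v.1 v.2

theorem hasSum_of_fiber {ι κ : Type*} {τ : ι → ℂ} {s : ℂ} (hτ : HasSum τ s) (π : ι → κ)
    (γ : κ → ℂ) (T : κ → Finset ι) (hT : ∀ v q, q ∈ T v ↔ π q = v)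
    (hγ : ∀ v, γ v = ∑ q ∈ T v, τ q) : HasSum γ s := by
  have h := hτ.tsum_fiberwise π
  have e : γ = fun v => ∑' b : π ⁻¹' {v}, τ b := by
    funext v
    have : (T v : Set ι) = π ⁻¹' {v} := by ext q; simp [hT]
    rw [hγ, ← Finset.tsum_subtype' (T v) τ, this]
  rwa [e]

theorem hasSum_mul_prod {ι κ : Type*} {f : ι → ℂ} {g : κ → ℂ} {s t : ℂ} (hf : HasSum f s)
    (hg : HasSum g t) : HasSum (fun q : ι × κ => f q.1 * g q.2) (s * t) :=
  hf.mul hg (summable_mul_of_summable_norm (f := f) (g := g) hf.summable.norm hg.summable.norm)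

theorem pnat_mul_pow_eq (d a : ℕ+) (i : ℕ) :
    ((d ^ i * a : ℕ+) : ℕ) / (d : ℕ) ^ i = a := by
  simp

/-- The product of the two series is indexed by `(d, a, b)` and regrouped along `(d, a, b) ↦ (d ^ i
* a, d ^ j * b)`, whose fibres are finite. -/
theorem hasSum_powConv {i j : ℕ} (hij : i ≠ 0 ∨ j ≠ 0) {ν₁ ν₂ : ℂ} {ψ : ℕ → ℂ} {f : ℕ → ℕ → ℂ}
    (hψ : Summable fun d : ℕ+ => ψ d * ((d : ℕ) : ℂ) ^ (-(i * ν₁ + j * ν₂)))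
    (hf : Summable (dirichletWeight ν₁ ν₂ f)) :
    HasSum (dirichletWeight ν₁ ν₂ (powConv i j ψ f))
      ((∑' d : ℕ+, ψ d * ((d : ℕ) : ℂ) ^ (-(i * ν₁ + j * ν₂))) *
        ∑' v, dirichletWeight ν₁ ν₂ f v) := by
  have hprod := hasSum_mul_prod hψ.hasSum hf.hasSum
  -- As `i` or `j` is positive, `d` is at most one of the coordinates of `v`, hence at most their
  -- product.
  let T : ℕ+ × ℕ+ → Finset (ℕ+ × ℕ+ × ℕ+) := fun v =>
    ((Icc 1 (v.1 * v.2)) ×ˢ (Icc 1 v.1 ×ˢ Icc 1 v.2)).filter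
      (fun q => (q.1 ^ i * q.2.1, q.1 ^ j * q.2.2) = v)
  have hT : ∀ v q, q ∈ T v ↔ (q.1 ^ i * q.2.1, q.1 ^ j * q.2.2) = v := by
    rintro v ⟨d, a, b⟩
    simp only [T, mem_filter, mem_product, mem_Icc, one_le, true_and, and_iff_right_iff_imp]
    rintro rfl
    dsimp only
    have hle : ∀ m n : ℕ+, n ≤ m * n := fun m n => by
      simp
    have hle' : ∀ m n : ℕ+, n ≤ n * m := fun m n => by rw [mul_comm]; exact hle m n
    refine ⟨?_, hle _ _, hle _ _⟩
    rcases hij with h | h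
    · exact (le_self_pow one_le h).trans ((hle' _ _).trans (hle' _ _))
    · exact (le_self_pow one_le h).trans ((hle' _ _).trans (hle _ _))
  refine hasSum_of_fiber hprod (fun q => (q.1 ^ i * q.2.1, q.1 ^ j * q.2.2)) _ T hT ?_
  · rintro ⟨a, b⟩
    unfold dirichletWeight powConv
    rw [mul_sum]
    symm
    refine sum_bij (fun q _ => (q.1 : ℕ)) ?_ ?_ ?_ ?_
    · rintro ⟨d, a', b'⟩ h
      rw [hT] at h
      simp only [Prod.mk.injEq] at h
      obtain ⟨rfl, rfl⟩ := h
      rw [mem_commonPowDivisors hij (PNat.ne_zero _) (PNat.ne_zero _)]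
      simp
    · rintro ⟨d, a', b'⟩ h ⟨d', a'', b''⟩ h' hd
      rw [hT] at h h'
      simp only [Prod.mk.injEq] at h h'
      obtain rfl : d = d' := PNat.coe_injective hd
      obtain ⟨rfl, rfl⟩ := h
      simp only [mul_right_inj] at h'
      simp [h'.1, h'.2]
    · intro d hd
      rw [mem_commonPowDivisors hij (PNat.ne_zero _) (PNat.ne_zero _)] at hd
      obtain ⟨⟨a', ha⟩, ⟨b', hb⟩⟩ := hd
      dsimp only at ha hb
      have ha0 := mul_ne_zero_iff.1 (ha ▸ PNat.ne_zero a)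
      have hb0 := mul_ne_zero_iff.1 (hb ▸ PNat.ne_zero b)
      have hd : d ≠ 0 := by
        rintro rfl
        rcases hij with h' | h'
        · exact ha0.1 (by simp [zero_pow h'])
        · exact hb0.1 (by simp [zero_pow h'])
      lift d to ℕ+ using hd.bot_lt
      lift a' to ℕ+ using ha0.2.bot_lt
      lift b' to ℕ+ using hb0.2.bot_lt
      refine ⟨(d, a', b'), ?_, rfl⟩
      rw [hT]
      exact Prod.ext (PNat.coe_injective (by simp [ha])) (PNat.coe_injective (by simp [hb]))
    · rintro ⟨d, a', b'⟩ h
      rw [hT] at h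
      simp only [Prod.mk.injEq] at h
      obtain ⟨rfl, rfl⟩ := h
      dsimp only
      rw [pnat_mul_pow_eq, pnat_mul_pow_eq]
      have hd : ((d : ℕ) : ℂ) ≠ 0 := by simp
      simp only [PNat.mul_coe, PNat.pow_coe, Nat.cast_mul,
        Complex.natCast_mul_natCast_cpow]
      rw [Nat.cast_pow, Nat.cast_pow, ← Complex.natCast_cpow_natCast_mul,
        ← Complex.natCast_cpow_natCast_mul, neg_add, Complex.cpow_add _ _ hd,
        mul_neg, mul_neg]
      ring

/-- Passing from `powConv i j d ^ t f` to `f` divides the Dirichlet series by a zeta value. -/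
theorem summable_and_tsum_powConv {i j t : ℕ} (hij : i ≠ 0 ∨ j ≠ 0) {ν₁ ν₂ w : ℂ}
    {f : ℕ → ℕ → ℂ} (hw : i * ν₁ + j * ν₂ - t = w) (hre : 1 < w.re)
    (hf : Summable (dirichletWeight ν₁ ν₂ (powConv i j (fun d => (d : ℂ) ^ t) f))) :
    Summable (dirichletWeight ν₁ ν₂ f) ∧
      ∑' v, dirichletWeight ν₁ ν₂ (powConv i j (fun d => (d : ℂ) ^ t) f) v =
        riemannZeta w * ∑' v, dirichletWeight ν₁ ν₂ f v := by
  have hpow : ∀ d : ℕ+, ((d : ℕ) : ℂ) ^ t * ((d : ℕ) : ℂ) ^ (-(i * ν₁ + j * ν₂)) =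
      1 / ((d : ℕ) : ℂ) ^ w := by
    intro d
    rw [← Complex.cpow_natCast, ← Complex.cpow_add _ _ (by simp), one_div, ← Complex.cpow_neg,
      ← hw]
    congr 1
    ring
  have hs : Summable fun n : ℕ => 1 / (n : ℂ) ^ w := Complex.summable_one_div_nat_cpow.2 hre
  have hs' : Summable fun d : ℕ+ => 1 / ((d : ℕ) : ℂ) ^ w := hs.comp_injective PNat.coe_injective
  have hz : ∑' d : ℕ+, 1 / ((d : ℕ) : ℂ) ^ w = riemannZeta w := by
    rw [zeta_eq_tsum_one_div_nat_add_one_cpow hre,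
      tsum_pnat_eq_tsum_succ (f := fun n : ℕ => 1 / (n : ℂ) ^ w)]
    simp
  have hμ : Summable fun d : ℕ+ => (ArithmeticFunction.moebius (d : ℕ) * ((d : ℕ) : ℂ) ^ t) *
      ((d : ℕ) : ℂ) ^ (-(i * ν₁ + j * ν₂)) := by
    refine Summable.of_norm_bounded hs'.norm fun d => ?_
    rw [mul_assoc, hpow, norm_mul]
    refine mul_le_of_le_one_left (norm_nonneg _) ?_
    rw [Complex.norm_intCast]
    exact_mod_cast ArithmeticFunction.abs_moebius_le_one
  -- Only the convolved series is known to converge; convolving it with `μ(d) d ^ t` recovers `f`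
  -- and its summability.
  have hinv := hasSum_powConv hij (ψ := fun d => ArithmeticFunction.moebius d * (d : ℂ) ^ t) hμ hf
  have hfs : Summable (dirichletWeight ν₁ ν₂ f) := by
    refine hinv.summable.congr fun v => ?_
    unfold dirichletWeight
    rw [powConv_moebius hij t f (PNat.ne_zero _) (PNat.ne_zero _)]
  refine ⟨hfs, ?_⟩
  have h := hasSum_powConv hij (ψ := fun d => (d : ℂ) ^ t) (hs'.congr fun d => (hpow d).symm) hfs
  rw [h.tsum_eq, ← hz]
  simp_rw [hpow]

/-! ### Flags in a box and the removal of primitivity -/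

/-- The Plücker relations, without the coprimality conditions. -/
def PluckerRel (v₁ v₂ v₃ v₄ v₁₂ v₁₃ v₁₄ v₂₃ v₃₄ : ℤ) : Prop :=
  v₁ * v₁₃ + v₂ * v₁₄ - v₄ * v₁₂ = 0 ∧ v₁ * v₂₃ = v₂ * v₁₃ - v₃ * v₁₂ ∧
    v₁ * v₃₄ = v₃ * v₁₄ - v₄ * v₁₃

theorem pluckerRel_scale {d d' : ℤ} (hd : d ≠ 0) (hd' : d' ≠ 0) (a x y t b z w u r : ℤ) :
    PluckerRel (d * a) (d * x) (d * y) (d * t) (d' * b) (d' * z) (d' * w) (d' * u) (d' * r) ↔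
      PluckerRel a x y t b z w u r := by
  have h : d * d' ≠ 0 := mul_ne_zero hd hd'
  unfold PluckerRel
  refine and_congr ?_ (and_congr ?_ ?_)
  · rw [show d * a * (d' * z) + d * x * (d' * w) - d * t * (d' * b) =
      (d * d') * (a * z + x * w - t * b) by ring]
    simp [h]
  · rw [show d * a * (d' * u) = (d * d') * (a * u) by ring,
      show d * x * (d' * z) - d * y * (d' * b) = (d * d') * (x * z - y * b) by ring,
      mul_right_inj' h]
  · rw [show d * a * (d' * r) = (d * d') * (a * r) by ring,
      show d * y * (d' * w) - d * t * (d' * z) = (d * d') * (y * w - t * z) by ring,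
      mul_right_inj' h]

/-- The coordinate `v₄` determined by `v = (v₂, v₃, v₁₃, v₁₄)`. -/
def coord₄ (a b : ℕ) (v : ℕ × ℕ × ℕ × ℕ) : ℤ := (a * v.2.2.1 + v.1 * v.2.2.2) / b

/-- The coordinate `v₂₃` determined by `v = (v₂, v₃, v₁₃, v₁₄)`. -/
def coord₂₃ (a b : ℕ) (v : ℕ × ℕ × ℕ × ℕ) : ℤ := (v.1 * v.2.2.1 - v.2.1 * b) / a

/-- The coordinate `v₃₄` determined by `v = (v₂, v₃, v₁₃, v₁₄)`. -/
def coord₃₄ (a b : ℕ) (v : ℕ × ℕ × ℕ × ℕ) : ℤ :=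
  (v.2.1 * v.2.2.2 - coord₄ a b v * v.2.2.1) / a

/-- The greatest common divisor of `v₁, v₂, v₃, v₄`. -/
def lineContent (a b : ℕ) (v : ℕ × ℕ × ℕ × ℕ) : ℕ :=
  Int.gcd a (Int.gcd v.1 (Int.gcd v.2.1 (coord₄ a b v)))

/-- The greatest common divisor of `v₁₂, v₁₃, v₁₄, v₂₃, v₃₄`. -/
def planeContent (a b : ℕ) (v : ℕ × ℕ × ℕ × ℕ) : ℕ :=
  Int.gcd b (Int.gcd v.2.2.1 (Int.gcd v.2.2.2 (Int.gcd (coord₂₃ a b v) (coord₃₄ a b v))))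

theorem PluckerRel.coords {a b : ℕ} {v : ℕ × ℕ × ℕ × ℕ} {t u r : ℤ} (ha : a ≠ 0) (hb : b ≠ 0)
    (h : PluckerRel a v.1 v.2.1 t b v.2.2.1 v.2.2.2 u r) :
    coord₄ a b v = t ∧ coord₂₃ a b v = u ∧ coord₃₄ a b v = r := by
  have h4 : coord₄ a b v = t := by
    rw [coord₄, sub_eq_zero.1 h.1, Int.mul_ediv_cancel _ (by exact_mod_cast hb)]
  refine ⟨h4, ?_, ?_⟩
  · rw [coord₂₃, ← h.2.1, Int.mul_ediv_cancel_left _ (by exact_mod_cast ha)]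
  · rw [coord₃₄, h4, ← h.2.2, Int.mul_ediv_cancel_left _ (by exact_mod_cast ha)]

open Classical in
/-- The tuples in the box which satisfy the Plücker relations. -/
def boxTuples (a b : ℕ) : Finset (ℕ × ℕ × ℕ × ℕ) :=
  (range a ×ˢ range a ×ˢ range b ×ˢ range b).filter
    fun v => ∃ t u r : ℤ, PluckerRel a v.1 v.2.1 t b v.2.2.1 v.2.2.2 u r

theorem mem_boxTuples {a b : ℕ} {v : ℕ × ℕ × ℕ × ℕ} : v ∈ boxTuples a b ↔
    (v.1 < a ∧ v.2.1 < a ∧ v.2.2.1 < b ∧ v.2.2.2 < b) ∧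
      ∃ t u r : ℤ, PluckerRel a v.1 v.2.1 t b v.2.2.1 v.2.2.2 u r := by
  simp [boxTuples]

theorem pluckerReps_eq {a b : ℕ} (ha : a ≠ 0) (hb : b ≠ 0) :
    pluckerReps a b =
      (boxTuples a b).filter fun v => lineContent a b v = 1 ∧ planeContent a b v = 1 := by
  ext v
  simp only [pluckerReps, boxTuples, mem_filter, and_assoc, and_congr_right_iff]
  rintro -
  constructor
  · rintro ⟨t, u, r, h1, h2, h3, h4, h5⟩
    have h : PluckerRel a v.1 v.2.1 t b v.2.2.1 v.2.2.2 u r := ⟨h1, h2, h3⟩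
    obtain ⟨e1, e2, e3⟩ := h.coords ha hb
    refine ⟨⟨t, u, r, h⟩, ?_, ?_⟩
    · rw [lineContent, e1]; exact h4
    · rw [planeContent, e2, e3]; exact h5
  · rintro ⟨⟨t, u, r, h⟩, h4, h5⟩
    obtain ⟨e1, e2, e3⟩ := h.coords ha hb
    rw [lineContent, e1] at h4
    rw [planeContent, e2, e3] at h5
    exact ⟨t, u, r, h.1, h.2.1, h.2.2, h4, h5⟩

/-- Scaling the two coordinate vectors. -/
def scaleTuple (d d' : ℕ) (v : ℕ × ℕ × ℕ × ℕ) : ℕ × ℕ × ℕ × ℕ :=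
  (d * v.1, d * v.2.1, d' * v.2.2.1, d' * v.2.2.2)

theorem scaleTuple_injective {d d' : ℕ} (hd : d ≠ 0) (hd' : d' ≠ 0) :
    Function.Injective (scaleTuple d d') := by
  rintro ⟨x, y, z, w⟩ ⟨x', y', z', w'⟩ h
  simpa [scaleTuple, hd, hd'] using h

theorem content_scaleTuple {a b d d' : ℕ} (ha : a ≠ 0) (hb : b ≠ 0) (hd : d ≠ 0) (hd' : d' ≠ 0)
    {v : ℕ × ℕ × ℕ × ℕ} (hv : v ∈ boxTuples a b) :
    lineContent (d * a) (d' * b) (scaleTuple d d' v) = d * lineContent a b v ∧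
      planeContent (d * a) (d' * b) (scaleTuple d d' v) = d' * planeContent a b v := by
  obtain ⟨-, t, u, r, h⟩ := mem_boxTuples.1 hv
  obtain ⟨e1, e2, e3⟩ := h.coords ha hb
  have h' := (pluckerRel_scale (d := d) (d' := d') (by exact_mod_cast hd) (by exact_mod_cast hd')
    _ _ _ _ _ _ _ _ _).2 h
  have h'' : PluckerRel ((d * a : ℕ) : ℤ) ((scaleTuple d d' v).1 : ℕ) ((scaleTuple d d' v).2.1 : ℕ)
      (d * t) ((d' * b : ℕ) : ℤ) ((scaleTuple d d' v).2.2.1 : ℕ)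
      ((scaleTuple d d' v).2.2.2 : ℕ) (d' * u) (d' * r) := by
    simpa [scaleTuple] using h'
  obtain ⟨f1, f2, f3⟩ := h''.coords (mul_ne_zero hd ha) (mul_ne_zero hd' hb)
  rw [lineContent, planeContent, lineContent, planeContent, e1, e2, e3, f1, f2, f3]
  simp only [scaleTuple, Nat.cast_mul, Int.gcd_mul_left, Int.natAbs_natCast, Nat.cast_mul]
  exact ⟨trivial, trivial⟩

/-- The relations are bihomogeneous in the two coordinate vectors and the box of residues scales
with its side lengths, so common factors can be divided out without leaving the box. -/
theorem filter_dvd_content {a b d d' : ℕ} (ha : a ≠ 0) (hb : b ≠ 0) (hd : d ≠ 0) (hd' : d' ≠ 0) :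
    ((boxTuples (d * a) (d' * b)).filter fun v =>
      d ∣ lineContent (d * a) (d' * b) v ∧ d' ∣ planeContent (d * a) (d' * b) v) =
      (boxTuples a b).image (scaleTuple d d') := by
  ext v
  simp only [mem_filter, mem_image]
  constructor
  · rintro ⟨hv, h1, h2⟩
    obtain ⟨⟨b1, b2, b3, b4⟩, t, u, r, h⟩ := mem_boxTuples.1 hv
    obtain ⟨e1, e2, e3⟩ := h.coords (mul_ne_zero hd ha) (mul_ne_zero hd' hb)
    rw [lineContent, e1] at h1
    rw [planeContent, e2, e3] at h2
    obtain ⟨x, y, z, w⟩ := v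
    rw [← Int.natCast_dvd_natCast] at h1
    simp only [Int.dvd_coe_gcd_iff, Int.natCast_dvd_natCast] at h1
    rw [← Int.natCast_dvd_natCast] at h2
    simp only [Int.dvd_coe_gcd_iff, Int.natCast_dvd_natCast] at h2
    obtain ⟨-, ⟨x, rfl⟩, ⟨y, rfl⟩, t, rfl⟩ := h1
    obtain ⟨-, ⟨z, rfl⟩, ⟨w, rfl⟩, ⟨u, rfl⟩, r, rfl⟩ := h2
    refine ⟨(x, y, z, w), mem_boxTuples.2 ⟨⟨?_, ?_, ?_, ?_⟩, t, u, r, ?_⟩, rfl⟩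
    · exact Nat.lt_of_mul_lt_mul_left b1
    · exact Nat.lt_of_mul_lt_mul_left b2
    · exact Nat.lt_of_mul_lt_mul_left b3
    · exact Nat.lt_of_mul_lt_mul_left b4
    · refine (pluckerRel_scale (d := d) (d' := d') (by exact_mod_cast hd)
        (by exact_mod_cast hd') _ _ _ _ _ _ _ _ _).1 ?_
      simpa using h
  · rintro ⟨v, hv, rfl⟩
    obtain ⟨⟨b1, b2, b3, b4⟩, t, u, r, h⟩ := mem_boxTuples.1 hv
    obtain ⟨c1, c2⟩ := content_scaleTuple ha hb hd hd' hv
    refine ⟨mem_boxTuples.2 ⟨⟨?_, ?_, ?_, ?_⟩, d * t, d' * u, d' * r, ?_⟩, ?_, ?_⟩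
    · exact Nat.mul_lt_mul_of_pos_left b1 hd.bot_lt
    · exact Nat.mul_lt_mul_of_pos_left b2 hd.bot_lt
    · exact Nat.mul_lt_mul_of_pos_left b3 hd'.bot_lt
    · exact Nat.mul_lt_mul_of_pos_left b4 hd'.bot_lt
    · simpa [scaleTuple] using (pluckerRel_scale (d := d) (d' := d') (by exact_mod_cast hd)
        (by exact_mod_cast hd') _ _ _ _ _ _ _ _ _).2 h
    · rw [c1]; exact dvd_mul_right _ _
    · rw [c2]; exact dvd_mul_right _ _

theorem content_dvd {a b : ℕ} (v : ℕ × ℕ × ℕ × ℕ) :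
    lineContent a b v ∣ a ∧ planeContent a b v ∣ b := by
  constructor
  · exact Int.natCast_dvd_natCast.1 (Int.gcd_dvd_left _ _)
  · exact Int.natCast_dvd_natCast.1 (Int.gcd_dvd_left _ _)

/-- The phase of a tuple. -/
def phase (a b : ℕ) (n₁ n₂ : ℤ) (v : ℕ × ℕ × ℕ × ℕ) : ℂ :=
  e (n₁ * v.1 / a + n₂ * v.2.2.2 / b)

theorem phase_scaleTuple {a b d d' : ℕ} (hd : d ≠ 0) (hd' : d' ≠ 0) (n₁ n₂ : ℤ)
    (v : ℕ × ℕ × ℕ × ℕ) :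
    phase (d * a) (d' * b) n₁ n₂ (scaleTuple d d' v) = phase a b n₁ n₂ v := by
  have h1 : (d : ℂ) ≠ 0 := by exact_mod_cast hd
  have h2 : (d' : ℂ) ≠ 0 := by exact_mod_cast hd'
  unfold phase scaleTuple
  push_cast
  congr 2
  · rw [mul_left_comm, mul_div_mul_left _ _ h1]
  · rw [mul_left_comm, mul_div_mul_left _ _ h2]

theorem sum_filter_dvd_content {a b d d' : ℕ} (ha : a ≠ 0) (hb : b ≠ 0) (hd : d ≠ 0)
    (hd' : d' ≠ 0) (F : ℕ × ℕ × ℕ × ℕ → ℂ) :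
    (∑ v ∈ (boxTuples (d * a) (d' * b)).filter fun v =>
      d ∣ lineContent (d * a) (d' * b) v ∧ d' ∣ planeContent (d * a) (d' * b) v, F v) =
      ∑ v ∈ boxTuples a b, F (scaleTuple d d' v) := by
  rw [filter_dvd_content ha hb hd hd', sum_image (scaleTuple_injective hd hd').injOn]

/-- The exponential sum over all tuples satisfying the Plücker relations. -/
def boxSum (n₁ n₂ : ℤ) (a b : ℕ) : ℂ := ∑ v ∈ boxTuples a b, phase a b n₁ n₂ v

/-- Dividing by the exact contents makes both vectors primitive, and the phase depends only on the
ratios `v₂ / v₁` and `v₁₄ / v₁₂`. -/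
theorem sum_filter_content_eq {a b d d' : ℕ} (ha : a ≠ 0) (hb : b ≠ 0) (hd : d ∣ a)
    (hd' : d' ∣ b) (n₁ n₂ : ℤ) :
    (∑ v ∈ (boxTuples a b).filter fun v => lineContent a b v = d ∧ planeContent a b v = d',
      phase a b n₁ n₂ v) = expSum (a / d) (b / d') n₁ n₂ := by
  obtain ⟨a, rfl⟩ := hd
  obtain ⟨b, rfl⟩ := hd'
  obtain ⟨hd, ha⟩ := mul_ne_zero_iff.1 ha
  obtain ⟨hd', hb⟩ := mul_ne_zero_iff.1 hb
  rw [Nat.mul_div_cancel_left _ hd.bot_lt, Nat.mul_div_cancel_left _ hd'.bot_lt, expSum,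
    pluckerReps_eq ha hb, sum_filter, sum_filter]
  have := sum_filter_dvd_content ha hb hd hd' fun v =>
    if lineContent (d * a) (d' * b) v = d ∧ planeContent (d * a) (d' * b) v = d' then
      phase (d * a) (d' * b) n₁ n₂ v else 0
  rw [sum_filter] at this
  convert this using 1
  · refine sum_congr rfl fun v _ => ?_
    by_cases h : lineContent (d * a) (d' * b) v = d ∧ planeContent (d * a) (d' * b) v = d'
    · rw [if_pos h, if_pos ⟨by rw [h.1], by rw [h.2]⟩]
    · rw [if_neg h, ite_self]
  · refine sum_congr rfl fun v hv => ?_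
    obtain ⟨c1, c2⟩ := content_scaleTuple ha hb hd hd' hv
    rw [c1, c2, phase_scaleTuple hd hd']
    simp [hd, hd', phase]

/-- Every flag in the box is sorted by its two contents, which divide `a` and `b`. -/
theorem powConv_expSum {a b : ℕ} (ha : a ≠ 0) (hb : b ≠ 0) (n₁ n₂ : ℤ) :
    powConv 0 1 (fun d => (d : ℂ) ^ 0) (powConv 1 0 (fun d => (d : ℂ) ^ 0)
      fun a b => expSum a b n₁ n₂) a b = boxSum n₁ n₂ a b := by
  have e1 : powConv 0 1 (fun d => (d : ℂ) ^ 0) (powConv 1 0 (fun d => (d : ℂ) ^ 0)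
      fun a b => expSum a b n₁ n₂) a b =
      ∑ d' ∈ b.divisors, ∑ d ∈ a.divisors, expSum (a / d) (b / d') n₁ n₂ := by
    unfold powConv
    simp only [pow_zero, pow_one, one_mul, Nat.div_one]
    refine sum_congr ?_ fun d' hd' => sum_congr ?_ fun d _ => rfl
    · ext d'
      rw [mem_commonPowDivisors (by simp) ha hb]
      simp [hb]
    · ext d
      have hd := Nat.mem_divisors.1 hd'
      rw [mem_commonPowDivisors (by simp) ha
        (Nat.div_pos (Nat.le_of_dvd hb.bot_lt hd.1) (Nat.pos_of_dvd_of_pos hd.1 hb.bot_lt)).ne']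
      simp [ha]
  rw [e1, sum_comm, boxSum]
  rw [← sum_fiberwise_of_maps_to (s := boxTuples a b) (t := a.divisors ×ˢ b.divisors)
    (g := fun v => (lineContent a b v, planeContent a b v)), sum_product]
  · refine sum_congr rfl fun d hd => sum_congr rfl fun d' hd' => ?_
    rw [← sum_filter_content_eq ha hb (Nat.dvd_of_mem_divisors hd) (Nat.dvd_of_mem_divisors hd')]
    simp
  · intro v _
    simp [ha, hb, content_dvd]

/-- The term `d` of the convolution is the sum over flags both of whose vectors are divisible by
`d`, so each flag collects the divisors common to its two contents. -/
theorem powConv_boxSum {a b : ℕ} (ha : a ≠ 0) (hb : b ≠ 0) (n₁ n₂ : ℤ) :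
    powConv 1 1 (fun d => (d : ℂ) ^ 1) (boxSum n₁ n₂) a b =
      ∑ v ∈ boxTuples a b, phase a b n₁ n₂ v *
        ((∑ d ∈ (Nat.gcd (lineContent a b v) (planeContent a b v)).divisors, d : ℕ) : ℂ) := by
  have h1 : ∀ d ∈ commonPowDivisors 1 1 a b, (d : ℂ) ^ 1 * boxSum n₁ n₂ (a / d ^ 1) (b / d ^ 1) =
      ∑ v ∈ boxTuples a b, if d ∣ lineContent a b v ∧ d ∣ planeContent a b v then
        phase a b n₁ n₂ v * d else 0 := by
    intro d hd
    rw [mem_commonPowDivisors (by simp) ha hb, pow_one] at hd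
    obtain ⟨⟨a, rfl⟩, b, rfl⟩ := hd
    obtain ⟨hd, ha⟩ := mul_ne_zero_iff.1 ha
    obtain ⟨-, hb⟩ := mul_ne_zero_iff.1 hb
    rw [pow_one, pow_one, Nat.mul_div_cancel_left _ hd.bot_lt, Nat.mul_div_cancel_left _ hd.bot_lt,
      boxSum, ← sum_filter, sum_filter_dvd_content ha hb hd hd, mul_sum]
    refine sum_congr rfl fun v _ => ?_
    rw [phase_scaleTuple hd hd, mul_comm]
  rw [powConv, sum_congr rfl h1, sum_comm]
  refine sum_congr rfl fun v _ => ?_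
  rw [← sum_filter, Nat.cast_sum, mul_sum]
  refine sum_congr ?_ fun _ _ => rfl
  ext d
  obtain ⟨c1, c2⟩ := content_dvd (a := a) (b := b) v
  simp only [mem_filter, mem_commonPowDivisors (i := 1) (j := 1) (by simp) ha hb,
    Nat.mem_divisors, pow_one, Nat.dvd_gcd_iff]
  constructor
  · rintro ⟨-, h⟩
    exact ⟨h, Nat.gcd_ne_zero_left fun h0 => ha (by rwa [h0, zero_dvd_iff] at c1)⟩
  · rintro ⟨h, -⟩
    exact ⟨⟨h.1.trans c1, h.2.trans c2⟩, h⟩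

/-! ### Counting rank-two lattices through a vector -/

theorem card_filter_dvd_sub {m : ℕ} (hm : m ≠ 0) (k : ℕ) (s : ℤ) :
    ((range (k * m)).filter fun f : ℕ => (m : ℤ) ∣ f - s).card = k := by
  have hm' : (m : ℤ) ≠ 0 := by exact_mod_cast hm
  have h := Nat.count_modEq_card (k * m) hm.bot_lt (s % m).toNat
  rw [Nat.count_eq_card_filter_range, Nat.mul_mod_left, Nat.mul_div_cancel _ hm.bot_lt,
    if_neg (Nat.not_lt_zero _), add_zero] at h
  refine Eq.trans (congrArg card (filter_congr fun f _ => ?_)) h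
  rw [← Int.natCast_modEq_iff, Int.toNat_of_nonneg (Int.emod_nonneg _ hm'), Int.modEq_comm,
    Int.modEq_iff_dvd]
  constructor
  · intro h1
    have := (Int.mod_modEq s m).dvd
    simpa using dvd_add h1 this
  · intro h1
    have := (Int.mod_modEq s m).symm.dvd
    simpa using dvd_add h1 this

/-- The number of solutions of three simultaneous linear congruences in one variable. -/
theorem card_filter_linear {k m : ℕ} (hk : k ≠ 0) (hm : m ≠ 0) {c₁ c₂ c₃ : ℤ} (r₁ r₂ r₃ : ℤ)
    (hc : Int.gcd c₁ (Int.gcd c₂ (Int.gcd c₃ m)) = 1) :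
    ((range (k * m)).filter fun f : ℕ => ((k * m : ℕ) : ℤ) ∣ f * (k * c₁) - r₁ ∧
      ((k * m : ℕ) : ℤ) ∣ f * (k * c₂) - r₂ ∧ ((k * m : ℕ) : ℤ) ∣ f * (k * c₃) - r₃).card =
      if ((k : ℤ) ∣ r₁ ∧ (k : ℤ) ∣ r₂ ∧ (k : ℤ) ∣ r₃) ∧ ((k * m : ℕ) : ℤ) ∣ c₁ * r₂ - c₂ * r₁ ∧
        ((k * m : ℕ) : ℤ) ∣ c₁ * r₃ - c₃ * r₁ ∧ ((k * m : ℕ) : ℤ) ∣ c₂ * r₃ - c₃ * r₂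
      then k else 0 := by
  have hk' : (k : ℤ) ≠ 0 := by exact_mod_cast hk
  have hkm : (k : ℤ) ∣ ((k * m : ℕ) : ℤ) := by simp
  split_ifs with h
  · obtain ⟨⟨⟨r₁, rfl⟩, ⟨r₂, rfl⟩, r₃, rfl⟩, h1, h2, h3⟩ := h
    have hdvd : ∀ s : ℤ, ((k * m : ℕ) : ℤ) ∣ k * s ↔ (m : ℤ) ∣ s := fun s => by
      rw [Nat.cast_mul, mul_dvd_mul_iff_left hk']
    rw [show c₁ * (k * r₂) - c₂ * (k * r₁) = k * (c₁ * r₂ - c₂ * r₁) by ring, hdvd] at h1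
    rw [show c₁ * (k * r₃) - c₃ * (k * r₁) = k * (c₁ * r₃ - c₃ * r₁) by ring, hdvd] at h2
    rw [show c₂ * (k * r₃) - c₃ * (k * r₂) = k * (c₂ * r₃ - c₃ * r₂) by ring, hdvd] at h3
    -- The Bézout relation combines the three congruences, with `k` divided out, into `f ≡ l₁ r₁ +
    -- l₂ r₂ + l₃ r₃` modulo `m`. Conversely, the vanishing of the cross terms modulo `m` lets this
    -- one congruence give back all three.
    obtain ⟨l₁, l₂, l₃, l, hl⟩ : ∃ l₁ l₂ l₃ l : ℤ, l₁ * c₁ + l₂ * c₂ + l₃ * c₃ + l * m = 1 := by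
      have g1 := Int.gcd_eq_gcd_ab c₁ (Int.gcd c₂ (Int.gcd c₃ m))
      have g2 := Int.gcd_eq_gcd_ab c₂ (Int.gcd c₃ m)
      have g3 := Int.gcd_eq_gcd_ab c₃ m
      rw [hc, Nat.cast_one] at g1
      generalize Int.gcdA c₁ _ = A₁, Int.gcdB c₁ _ = B₁ at g1
      generalize Int.gcdA c₂ _ = A₂, Int.gcdB c₂ _ = B₂ at g2
      generalize Int.gcdA c₃ _ = A₃, Int.gcdB c₃ _ = B₃ at g3
      exact ⟨A₁, B₁ * A₂, B₁ * B₂ * A₃, B₁ * B₂ * B₃, by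
        linear_combination -g1 - B₁ * g2 - B₁ * B₂ * g3⟩
    obtain ⟨q1, h1⟩ := h1
    obtain ⟨q2, h2⟩ := h2
    obtain ⟨q3, h3⟩ := h3
    refine Eq.trans (congrArg card (filter_congr fun f _ => ?_))
      (card_filter_dvd_sub hm k (l₁ * r₁ + l₂ * r₂ + l₃ * r₃))
    rw [show (f : ℤ) * (k * c₁) - k * r₁ = k * (f * c₁ - r₁) by ring,
      show (f : ℤ) * (k * c₂) - k * r₂ = k * (f * c₂ - r₂) by ring,
      show (f : ℤ) * (k * c₃) - k * r₃ = k * (f * c₃ - r₃) by ring, hdvd, hdvd, hdvd]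
    constructor
    · rintro ⟨⟨p1, e1⟩, ⟨p2, e2⟩, p3, e3⟩
      refine ⟨l₁ * p1 + l₂ * p2 + l₃ * p3 + f * l, ?_⟩
      linear_combination -(f : ℤ) * hl + l₁ * e1 + l₂ * e2 + l₃ * e3
    · rintro ⟨p, hp⟩
      refine ⟨⟨p * c₁ + l₂ * q1 + l₃ * q2 - l * r₁, ?_⟩, ⟨p * c₂ - l₁ * q1 + l₃ * q3 - l * r₂, ?_⟩,
        ⟨p * c₃ - l₁ * q2 - l₂ * q3 - l * r₃, ?_⟩⟩
      · linear_combination c₁ * hp + r₁ * hl + l₂ * h1 + l₃ * h2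
      · linear_combination c₂ * hp + r₂ * hl - l₁ * h1 + l₃ * h3
      · linear_combination c₃ * hp + r₃ * hl - l₁ * h2 - l₂ * h3
  · rw [card_eq_zero, filter_eq_empty_iff]
    rintro f - ⟨h1, h2, h3⟩
    refine h ⟨⟨?_, ?_, ?_⟩, ?_, ?_, ?_⟩
    · exact (dvd_sub_right (((dvd_mul_right _ _).mul_left _))).1 (hkm.trans h1)
    · exact (dvd_sub_right (((dvd_mul_right _ _).mul_left _))).1 (hkm.trans h2)
    · exact (dvd_sub_right (((dvd_mul_right _ _).mul_left _))).1 (hkm.trans h3)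
    · exact (by ring : c₁ * r₂ - c₂ * r₁ = c₂ * (f * (k * c₁) - r₁) - c₁ * (f * (k * c₂) - r₂)) ▸
        dvd_sub (h1.mul_left _) (h2.mul_left _)
    · exact (by ring : c₁ * r₃ - c₃ * r₁ = c₃ * (f * (k * c₁) - r₁) - c₁ * (f * (k * c₃) - r₃)) ▸
        dvd_sub (h1.mul_left _) (h3.mul_left _)
    · exact (by ring : c₂ * r₃ - c₃ * r₂ = c₃ * (f * (k * c₂) - r₂) - c₂ * (f * (k * c₃) - r₃)) ▸
        dvd_sub (h2.mul_left _) (h3.mul_left _)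

-- The right side counts lattices with basis `(A, f, g, h)`, `(0, D, v₁₃ / A, v₁₄ / A)`, where `D =
-- b / A`. The first two congruences make `g` and `h`, as prescribed by the minors `v₂₃` and `v₂₄ =
-- -v₁₃`, integral; the third puts the vector `(v₁, v₂, v₃, v₄)` in the lattice. The two sides are
-- matched term by term, with `A = g / k` for `g = gcd(v₁, v₁₂, v₁₃, v₁₄)`: there are `k` admissible
-- `f` if `k` divides both contents and none otherwise.
open Classical in
theorem sum_divisors_content {a b : ℕ} (ha : a ≠ 0) (hb : b ≠ 0) {v : ℕ × ℕ × ℕ × ℕ}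
    {t u r : ℤ} (h : PluckerRel a v.1 v.2.1 t b v.2.2.1 v.2.2.2 u r) :
    ∑ d ∈ (Nat.gcd (lineContent a b v) (planeContent a b v)).divisors, d =
      ∑ A ∈ (Nat.gcd a b).divisors, if A ∣ v.2.2.1 ∧ A ∣ v.2.2.2 then
        ((range (b / A)).filter fun f : ℕ =>
          ((b / A : ℕ) : ℤ) ∣ f * (v.2.2.1 / A : ℕ) - u ∧
          ((b / A : ℕ) : ℤ) ∣ f * (v.2.2.2 / A : ℕ) - -(v.2.2.1 : ℤ) ∧
          ((b / A : ℕ) : ℤ) ∣ f * (a / A : ℕ) - v.1).card else 0 := by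
  obtain ⟨e1, e2, e3⟩ := h.coords ha hb
  obtain ⟨x, y, z, w⟩ := v
  have hc1 : ∀ k : ℕ, k ∣ Nat.gcd (lineContent a b (x, y, z, w)) (planeContent a b (x, y, z, w)) ↔
      (k ∣ a ∧ k ∣ x ∧ k ∣ y ∧ (k : ℤ) ∣ t) ∧ k ∣ b ∧ k ∣ z ∧ k ∣ w ∧ (k : ℤ) ∣ u ∧ (k : ℤ) ∣ r := by
    intro k
    rw [Nat.dvd_gcd_iff, lineContent, planeContent, e1, e2, e3]
    simp only [← Int.natCast_dvd_natCast, Int.dvd_coe_gcd_iff]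
  dsimp only at h ⊢
  set g := Nat.gcd (Nat.gcd a b) (Nat.gcd z w) with hg
  have hg0 : g ≠ 0 := Nat.gcd_ne_zero_left (Nat.gcd_ne_zero_left ha)
  rw [← sum_filter]
  have s1 : (Nat.gcd a b).divisors.filter (fun A => A ∣ z ∧ A ∣ w) = g.divisors := by
    ext A
    simp [hg, Nat.dvd_gcd_iff, ha]
  rw [s1, ← Nat.sum_div_divisors g]
  have s2 : (Nat.gcd (lineContent a b (x, y, z, w)) (planeContent a b (x, y, z, w))).divisors =
      g.divisors.filter fun k =>
        k ∣ Nat.gcd (lineContent a b (x, y, z, w)) (planeContent a b (x, y, z, w)) := by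
    ext k
    have hne : Nat.gcd (lineContent a b (x, y, z, w)) (planeContent a b (x, y, z, w)) ≠ 0 :=
      fun h0 => ha (by have := ((hc1 0).1 (by rw [h0])).1.1; rwa [zero_dvd_iff] at this)
    simp only [Nat.mem_divisors, mem_filter, hc1, hg, Nat.dvd_gcd_iff]
    have := hg0
    rw [hg] at this
    tauto
  rw [s2, sum_filter]
  refine sum_congr rfl fun k hk => ?_
  obtain ⟨⟨A, hA⟩, -⟩ := Nat.mem_divisors.1 hk
  have hk0 : k ≠ 0 := by rintro rfl; exact hg0 (by simpa using hA)
  have hA0 : A ≠ 0 := by rintro rfl; exact hg0 (by simpa using hA)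
  obtain ⟨a₀, ha₀⟩ : g ∣ a := (Nat.gcd_dvd_left _ _).trans (Nat.gcd_dvd_left _ _)
  obtain ⟨b₀, hb₀⟩ : g ∣ b := (Nat.gcd_dvd_left _ _).trans (Nat.gcd_dvd_right _ _)
  obtain ⟨z₀, hz₀⟩ : g ∣ z := (Nat.gcd_dvd_right _ _).trans (Nat.gcd_dvd_left _ _)
  obtain ⟨w₀, hw₀⟩ : g ∣ w := (Nat.gcd_dvd_right _ _).trans (Nat.gcd_dvd_right _ _)
  have hb₀0 : b₀ ≠ 0 := by rintro rfl; exact hb (by simpa using hb₀)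
  -- Dividing by the full gcd `g` supplies the primitivity needed for `card_filter_linear`.
  have hprim : Int.gcd z₀ (Int.gcd w₀ (Int.gcd a₀ b₀)) = 1 := by
    have : g * Nat.gcd (Nat.gcd a₀ b₀) (Nat.gcd z₀ w₀) = g := by
      conv_rhs => rw [hg, ha₀, hb₀, hz₀, hw₀]
      rw [Nat.gcd_mul_left, Nat.gcd_mul_left, Nat.gcd_mul_left]
    have := Nat.eq_of_mul_eq_mul_left hg0.bot_lt (this.trans (mul_one g).symm)
    simp only [Int.gcd_natCast_natCast]
    rw [← this, Nat.gcd_comm (Nat.gcd a₀ b₀), Nat.gcd_assoc]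
  have hq : ∀ n, g * n / A = k * n := fun n => by
    rw [hA, mul_right_comm, Nat.mul_div_cancel _ hA0.bot_lt]
  have hgk : g / k = A := by rw [hA, Nat.mul_div_cancel_left _ hk0.bot_lt]
  have hkg : k ∣ g := ⟨A, hA⟩
  have hlin := card_filter_linear hk0 hb₀0 u (-z) x hprim
  have hgz : (g : ℤ) ≠ 0 := by exact_mod_cast hg0
  have haz : (a : ℤ) ≠ 0 := by exact_mod_cast ha
  obtain ⟨p1, p2, p3⟩ := h
  have cz : (z : ℤ) = g * z₀ := by exact_mod_cast hz₀
  have cw : (w : ℤ) = g * w₀ := by exact_mod_cast hw₀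
  have ca : (a : ℤ) = g * a₀ := by exact_mod_cast ha₀
  have cb : (b : ℤ) = g * b₀ := by exact_mod_cast hb₀
  -- By the Plücker relations the three cross terms are `b₀` times `v₃₄`, `v₃`, `v₄`. Solvability
  -- therefore amounts to divisibility of the remaining coordinates by `k`.
  have m1 : (z₀ : ℤ) * -z - w₀ * u = b₀ * r := by
    refine mul_left_cancel₀ hgz (mul_left_cancel₀ haz ?_)
    linear_combination (a : ℤ) * (z * cz + u * cw + r * cb) - b * p3 - w * p2 - z * p1
  have m2 : (z₀ : ℤ) * x - a₀ * u = b₀ * y := by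
    refine mul_left_cancel₀ hgz ?_
    linear_combination -x * cz + u * ca + y * cb - p2
  have m3 : (w₀ : ℤ) * x - a₀ * -z = b₀ * t := by
    refine mul_left_cancel₀ hgz ?_
    linear_combination -x * cw - z * ca + t * cb + p1
  have hdvd : ∀ s : ℤ, ((k * b₀ : ℕ) : ℤ) ∣ b₀ * s ↔ (k : ℤ) ∣ s := fun s => by
    rw [Nat.cast_mul, mul_comm, mul_dvd_mul_iff_left (by exact_mod_cast hb₀0)]
  simp only [m1, m2, m3, hdvd] at hlin
  have hkz : k ∣ z := hkg.trans ⟨_, hz₀⟩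
  have hiff : k ∣ Nat.gcd (lineContent a b (x, y, z, w)) (planeContent a b (x, y, z, w)) ↔
      ((k : ℤ) ∣ u ∧ (k : ℤ) ∣ -z ∧ (k : ℤ) ∣ x) ∧ (k : ℤ) ∣ r ∧ (k : ℤ) ∣ y ∧ (k : ℤ) ∣ t := by
    rw [hc1, dvd_neg, Int.natCast_dvd_natCast, Int.natCast_dvd_natCast, Int.natCast_dvd_natCast]
    have q1 : k ∣ a := hkg.trans ⟨_, ha₀⟩
    have q2 : k ∣ b := hkg.trans ⟨_, hb₀⟩
    have q3 : k ∣ w := hkg.trans ⟨_, hw₀⟩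
    tauto
  simp only [hiff]
  rw [hgk, ← hlin]
  have ez : z / A = k * z₀ := by rw [hz₀, hq]
  have ew : w / A = k * w₀ := by rw [hw₀, hq]
  have ea : a / A = k * a₀ := by rw [ha₀, hq]
  have eb : b / A = k * b₀ := by rw [hb₀, hq]
  rw [ez, ew, ea, eb]
  push_cast
  rfl

/-! ### Exponential sums for a fixed lattice -/

theorem e_add (x y : ℂ) : e (x + y) = e x * e y := by
  rw [e, e, e, ← Complex.exp_add, mul_add]

theorem sum_range_e {N : ℕ} (hN : N ≠ 0) (n : ℤ) :
    ∑ x ∈ range N, e (n * x / N) = if (N : ℤ) ∣ n then (N : ℂ) else 0 := by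
  have hN' : (N : ℂ) ≠ 0 := by exact_mod_cast hN
  have hpow : ∀ x : ℕ, e (n * x / N) = e (n / N) ^ x := by
    intro x
    rw [e, e, ← Complex.exp_nat_mul]
    congr 1
    ring
  have hone : e (n / N) = 1 ↔ (N : ℤ) ∣ n := by
    rw [e, Complex.exp_eq_one_iff]
    constructor
    · rintro ⟨k, hk⟩
      refine ⟨k, ?_⟩
      have h2 : (2 * Real.pi * Complex.I : ℂ) ≠ 0 := Complex.two_pi_I_ne_zero
      have h3 : (n : ℂ) / N = k := mul_left_cancel₀ h2 (by rw [hk]; ring)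
      rw [div_eq_iff hN'] at h3
      exact_mod_cast h3.trans (mul_comm _ _)
    · rintro ⟨k, rfl⟩
      refine ⟨k, ?_⟩
      push_cast
      field_simp
  simp_rw [hpow]
  split_ifs with h
  · simp [hone.2 h]
  · have h1 := mul_neg_geom_sum (e (n / N)) N
    have h2 : e (n / N) ^ N = 1 := by
      rw [← hpow, mul_div_assoc, div_self hN', mul_one, e, Complex.exp_eq_one_iff]
      exact ⟨n, by ring⟩
    rw [h2, sub_self, mul_eq_zero, sub_eq_zero] at h1
    exact h1.resolve_left fun h' => h (hone.1 h'.symm)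

theorem sum_range_mul_ite_dvd {M : Type*} [AddCommMonoid M] {k : ℕ} (hk : k ≠ 0) (N : ℕ)
    (F : ℕ → M) :
    ∑ x ∈ range (k * N), (if k ∣ x then F x else 0) = ∑ x ∈ range N, F (k * x) := by
  rw [← sum_filter]
  symm
  refine sum_bij (fun x _ => k * x) ?_ ?_ ?_ ?_
  · intro x hx
    simp only [mem_filter, mem_range, dvd_mul_right, and_true] at hx ⊢
    exact Nat.mul_lt_mul_of_pos_left hx hk.bot_lt
  · intro x _ y _ h
    exact Nat.eq_of_mul_eq_mul_left hk.bot_lt h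
  · intro x hx
    simp only [mem_filter, mem_range] at hx
    obtain ⟨h, y, rfl⟩ := hx
    exact ⟨y, mem_range.2 (Nat.lt_of_mul_lt_mul_left h), rfl⟩
  · intro x _
    rfl

theorem sum_range_e_dvd {k N : ℕ} (hk : k ≠ 0) (hN : N ≠ 0) (n : ℤ) :
    ∑ x ∈ range (k * N), (if k ∣ x then e (n * x / (k * N : ℕ)) else 0) =
      if (N : ℤ) ∣ n then (N : ℂ) else 0 := by
  have hk' : (k : ℂ) ≠ 0 := by exact_mod_cast hk
  rw [sum_range_mul_ite_dvd hk, ← sum_range_e hN]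
  refine sum_congr rfl fun x _ => ?_
  push_cast
  rw [mul_left_comm, mul_div_mul_left _ _ hk']

theorem card_filter_dvd_mul_sub {c N : ℕ} (hN : N ≠ 0) (r : ℤ) :
    ((range N).filter fun f : ℕ => (N : ℤ) ∣ f * c - r).card =
      if ((Nat.gcd c N : ℕ) : ℤ) ∣ r then Nat.gcd c N else 0 := by
  have hg : Nat.gcd c N ≠ 0 := Nat.gcd_ne_zero_right hN
  obtain ⟨c', hc⟩ := Nat.gcd_dvd_left c N
  obtain ⟨N', hN'⟩ := Nat.gcd_dvd_right c N
  have hN0 : N' ≠ 0 := by rintro rfl; exact hN (by simpa using hN')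
  have hcop : Nat.gcd c' N' = 1 := by
    have : Nat.gcd c N * Nat.gcd c' N' = Nat.gcd c N := by
      rw [← Nat.gcd_mul_left, ← hc, ← hN']
    exact Nat.eq_of_mul_eq_mul_left hg.bot_lt (this.trans (mul_one _).symm)
  have h := card_filter_linear hg hN0 (c₁ := c') (c₂ := 0) (c₃ := 0) r 0 0 (by simpa using hcop)
  rw [← hN'] at h
  have e1 : ((Nat.gcd c N : ℕ) : ℤ) * c' = c := by exact_mod_cast hc.symm
  rw [e1] at h
  simpa using h

/-- With `x = f α + D x₁`, the vector must be `α` times the first basis vector plus `x₁` times the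
second. The third coordinate then reads `y = α l + x₁ z` with `l` an integer, and this is the only
condition left. -/
theorem pluckerRel_iff_of_dvd {A α D : ℕ} (hA : A ≠ 0) (hα : α ≠ 0) (hD : D ≠ 0)
    (x y z w f : ℕ) {x₁ : ℤ} :
    ((∃ t u r : ℤ, PluckerRel (A * α : ℕ) x y t (A * D : ℕ) (A * z : ℕ) (A * w : ℕ) u r) ∧
      (D : ℤ) ∣ f * z - coord₂₃ (A * α) (A * D) (x, y, A * z, A * w)) ∧
      (D : ℤ) ∣ f * w - -((A * z : ℕ) : ℤ) ∧ (x : ℤ) - f * α = D * x₁ ↔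
    ((α : ℤ) ∣ y - x₁ * z) ∧ (D : ℤ) ∣ f * w - -((A * z : ℕ) : ℤ) ∧ (x : ℤ) - f * α = D * x₁ := by
  refine and_congr_left ?_
  rintro ⟨⟨q, hq⟩, hx⟩
  have hA' : (A : ℤ) ≠ 0 := by exact_mod_cast hA
  have hD' : (D : ℤ) ≠ 0 := by exact_mod_cast hD
  have hα' : (α : ℤ) ≠ 0 := by exact_mod_cast hα
  push_cast at hq
  constructor
  · rintro ⟨⟨t, u, r, h⟩, h2⟩
    have hc := (h.coords (v := (x, y, A * z, A * w)) (mul_ne_zero hA hα) (mul_ne_zero hA hD)).2.1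
    rw [hc] at h2
    obtain ⟨l, hl⟩ := h2
    have h3 := h.2.1
    push_cast at h3
    refine ⟨l, mul_left_cancel₀ hD' (mul_left_cancel₀ hA' ?_)⟩
    linear_combination h3 + A * α * hl + A * z * hx
  · rintro ⟨l, hl⟩
    -- These are the coordinates of `α (A, f, l, q) + x₁ (0, D, z, w)` and the minors of the two
    -- basis vectors.
    have h : PluckerRel (A * α : ℕ) x y (x₁ * w + α * q) (A * D : ℕ) (A * z : ℕ) (A * w : ℕ)
        (f * z - D * l) (l * w - q * z) := by
      refine ⟨?_, ?_, ?_⟩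
      · push_cast
        linear_combination A * α * hq + A * w * hx
      · push_cast
        linear_combination A * D * hl - A * z * hx
      · push_cast
        linear_combination -A * w * hl
    refine ⟨⟨_, _, _, h⟩, ?_⟩
    have hc := (h.coords (v := (x, y, A * z, A * w)) (mul_ne_zero hA hα) (mul_ne_zero hA hD)).2.1
    rw [hc]
    exact ⟨l, by ring⟩

theorem sum_comm_four {α β γ δ M : Type*} [AddCommMonoid M] (s₁ : Finset α) (s₂ : Finset β)
    (s₃ : Finset γ) (s₄ : Finset δ) (G : α → β → γ → δ → M) :
    ∑ y ∈ s₁, ∑ z ∈ s₂, ∑ w ∈ s₃, ∑ f ∈ s₄, G y z w f =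
      ∑ f ∈ s₄, ∑ w ∈ s₃, ∑ z ∈ s₂, ∑ y ∈ s₁, G y z w f := by
  have h3 : ∀ y, ∑ z ∈ s₂, ∑ w ∈ s₃, ∑ f ∈ s₄, G y z w f =
      ∑ f ∈ s₄, ∑ w ∈ s₃, ∑ z ∈ s₂, G y z w f := fun y => by
    rw [sum_comm]
    simp_rw [sum_comm (s := s₂)]
    rw [sum_comm]
  simp_rw [h3]
  rw [sum_comm]
  refine sum_congr rfl fun f _ => ?_
  rw [sum_comm]
  exact sum_congr rfl fun w _ => sum_comm

/-- The `v₁₃`- and `v₁₄`-sums for fixed `v₂` and fixed parameter `f` of the sublattice. -/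
theorem sum_phase_plane {A D : ℕ} (hD : D ≠ 0) (f : ℕ) (n : ℤ) :
    ∑ w ∈ range D, ∑ z ∈ range D,
      (if (D : ℤ) ∣ f * w - -((A * z : ℕ) : ℤ) then e (n * w / D) * A else 0) =
      if ((D / Nat.gcd A D * Nat.gcd f (Nat.gcd A D) : ℕ) : ℤ) ∣ n then
        ((A * D * Nat.gcd f (Nat.gcd A D) : ℕ) : ℂ) else 0 := by
  set g := Nat.gcd A D with hg
  have hg0 : g ≠ 0 := Nat.gcd_ne_zero_right hD
  set h := Nat.gcd f g with hh
  have hh0 : h ≠ 0 := Nat.gcd_ne_zero_right hg0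
  obtain ⟨k, hk⟩ : h ∣ g := Nat.gcd_dvd_right _ _
  obtain ⟨D', hD'⟩ : g ∣ D := Nat.gcd_dvd_right _ _
  obtain ⟨f', hf'⟩ : h ∣ f := Nat.gcd_dvd_left _ _
  have hk0 : k ≠ 0 := by rintro rfl; exact hg0 (by simpa using hk)
  have hD'0 : D' ≠ 0 := by rintro rfl; exact hD (by simpa using hD')
  have hcop : Nat.gcd k f' = 1 := by
    have : h * Nat.gcd f' k = h := by
      rw [← Nat.gcd_mul_left, ← hk, ← hf']
    rw [Nat.gcd_comm]
    exact Nat.eq_of_mul_eq_mul_left hh0.bot_lt (this.trans (mul_one _).symm)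
  -- For given `w` the congruence in `z` has `g` solutions when `g ∣ f w`, that is when `k = g /
  -- gcd(f, g)` divides `w`, and none otherwise.
  have hinner : ∀ w : ℕ, ∑ z ∈ range D,
      (if (D : ℤ) ∣ f * w - -((A * z : ℕ) : ℤ) then e (n * w / D) * A else 0) =
      (if k ∣ w then e (n * w / D) else 0) * (A * g) := by
    intro w
    have hcount := card_filter_dvd_mul_sub (c := A) hD (-(f * w : ℤ))
    rw [← sum_filter, sum_const, nsmul_eq_mul]
    have hset : ((range D).filter fun z : ℕ => (D : ℤ) ∣ f * w - -((A * z : ℕ) : ℤ)) =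
        (range D).filter fun z : ℕ => (D : ℤ) ∣ z * A - -(f * w : ℤ) := by
      refine filter_congr fun z _ => ?_
      rw [show (f : ℤ) * w - -((A * z : ℕ) : ℤ) = z * A - -(f * w : ℤ) by push_cast; ring]
    have hiff : ((g : ℕ) : ℤ) ∣ -(f * w : ℤ) ↔ k ∣ w := by
      rw [dvd_neg, ← Nat.cast_mul, Int.natCast_dvd_natCast, hk, hf', mul_assoc,
        mul_dvd_mul_iff_left hh0]
      exact Nat.Coprime.dvd_mul_left hcop
    rw [hset, hcount, ← hg]
    simp only [hiff]
    split_ifs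
    · ring
    · simp
  simp_rw [hinner]
  rw [← sum_mul]
  have hDk : D = k * (D' * h) := by rw [hD', hk]; ring
  have hsum := sum_range_e_dvd hk0 (mul_ne_zero hD'0 hh0) n
  rw [← hDk] at hsum
  rw [hsum]
  have hDg : D / g = D' := by
    conv_lhs => rw [hD']
    exact Nat.mul_div_cancel_left _ hg0.bot_lt
  rw [hDg, ite_mul, zero_mul]
  congr 1
  rw [show A * D * h = A * (g * D') * h by rw [← hD']]
  push_cast
  ring

-- The sum over flags and lattices is interchanged. For a fixed lattice and fixed `x`, the
-- coordinate `y` is determined modulo `α`, which leaves `A` choices in the box, and the sums over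
-- `z` and `w` are those of `sum_phase_plane`.
open Classical in
theorem sum_box_sublattice {A α D : ℕ} (hA : A ≠ 0) (hα : α ≠ 0) (hD : D ≠ 0) (n₁ n₂ : ℤ) :
    ∑ v ∈ boxTuples (A * α) (A * D), phase (A * α) (A * D) n₁ n₂ v *
      ((if A ∣ v.2.2.1 ∧ A ∣ v.2.2.2 then
        ((range D).filter fun f : ℕ =>
          (D : ℤ) ∣ f * (v.2.2.1 / A : ℕ) - coord₂₃ (A * α) (A * D) v ∧
          (D : ℤ) ∣ f * (v.2.2.2 / A : ℕ) - -(v.2.2.1 : ℤ) ∧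
          (D : ℤ) ∣ f * α - v.1).card else 0 : ℕ) : ℂ) =
      ∑ f ∈ range D, ∑ x ∈ range (A * α), if (D : ℤ) ∣ x - f * α then
        e (n₁ * x / (A * α : ℕ)) *
          (if ((D / Nat.gcd A D * Nat.gcd f (Nat.gcd A D) : ℕ) : ℤ) ∣ n₂ then
            ((A * D * Nat.gcd f (Nat.gcd A D) : ℕ) : ℂ) else 0) else 0 := by
  have hA' : (A : ℂ) ≠ 0 := by exact_mod_cast hA
  let Q : ℕ → ℕ → ℕ → ℕ → ℕ → Prop := fun x y z w f =>
    (∃ t u r : ℤ, PluckerRel (A * α : ℕ) x y t (A * D : ℕ) z w u r) ∧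
      (D : ℤ) ∣ f * (z / A : ℕ) - coord₂₃ (A * α) (A * D) (x, y, z, w) ∧
        (D : ℤ) ∣ f * (w / A : ℕ) - -(z : ℤ) ∧ (D : ℤ) ∣ f * α - x
  let ph : ℕ → ℕ → ℂ := fun x w => e (n₁ * x / (A * α : ℕ) + n₂ * w / (A * D : ℕ))
  have h1 : ∀ x y z w : ℕ, (if ∃ t u r : ℤ, PluckerRel (A * α : ℕ) x y t (A * D : ℕ) z w u r then
      ph x w * ((if A ∣ z ∧ A ∣ w then
        ((range D).filter fun f : ℕ =>
          (D : ℤ) ∣ f * (z / A : ℕ) - coord₂₃ (A * α) (A * D) (x, y, z, w) ∧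
          (D : ℤ) ∣ f * (w / A : ℕ) - -(z : ℤ) ∧
          (D : ℤ) ∣ f * α - x).card else 0 : ℕ) : ℂ) else 0) =
      if A ∣ z then (if A ∣ w then ∑ f ∈ range D, if Q x y z w f then ph x w else 0 else 0)
        else 0 := by
    intro x y z w
    by_cases hz : A ∣ z
    · by_cases hw : A ∣ w
      · by_cases hr : ∃ t u r : ℤ, PluckerRel (A * α : ℕ) x y t (A * D : ℕ) z w u r
        · rw [if_pos hr, if_pos ⟨hz, hw⟩, if_pos hz, if_pos hw, ← sum_filter, sum_const,
            nsmul_eq_mul, mul_comm]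
          simp only [Q, hr, true_and]
        · rw [if_neg hr, if_pos hz, if_pos hw]
          simp only [Q, hr, false_and, if_false, sum_const_zero]
      · simp [hw]
    · simp [hz]
  have h2 : ∀ x y : ℕ, ∑ z ∈ range (A * D), ∑ w ∈ range (A * D),
      (if A ∣ z then (if A ∣ w then ∑ f ∈ range D, if Q x y z w f then ph x w else 0 else 0)
        else 0) = ∑ z ∈ range D, ∑ w ∈ range D, ∑ f ∈ range D,
          if Q x y (A * z) (A * w) f then ph x (A * w) else 0 := by
    intro x y
    rw [← sum_range_mul_ite_dvd hA D fun z => ∑ w ∈ range D, ∑ f ∈ range D,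
      if Q x y z (A * w) f then ph x (A * w) else 0]
    refine sum_congr rfl fun z _ => ?_
    rw [← sum_range_mul_ite_dvd hA D fun w => ∑ f ∈ range D,
      if Q x y z w f then ph x w else 0]
    split_ifs <;> simp
  have h3 : ∀ x z w f : ℕ, ∑ y ∈ range (A * α),
      (if Q x y (A * z) (A * w) f then ph x (A * w) else 0) =
      if (D : ℤ) ∣ x - f * α then e (n₁ * x / (A * α : ℕ)) *
        (if (D : ℤ) ∣ f * w - -((A * z : ℕ) : ℤ) then e (n₂ * w / D) * A else 0) else 0 := by
    intro x z w f
    have hQ : ∀ y, Q x y (A * z) (A * w) f ↔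
        ((∃ t u r : ℤ, PluckerRel (A * α : ℕ) x y t (A * D : ℕ) (A * z : ℕ) (A * w : ℕ) u r) ∧
          (D : ℤ) ∣ f * z - coord₂₃ (A * α) (A * D) (x, y, A * z, A * w)) ∧
          (D : ℤ) ∣ f * w - -((A * z : ℕ) : ℤ) ∧ (D : ℤ) ∣ x - f * α := by
      intro y
      simp only [Q, Nat.mul_div_cancel_left _ hA.bot_lt]
      rw [dvd_sub_comm (b := (f : ℤ) * α)]
      tauto
    split_ifs with hx hw
    · obtain ⟨x₁, hx₁⟩ := hx
      have hQ' : ∀ y, Q x y (A * z) (A * w) f ↔ (α : ℤ) ∣ y - x₁ * z := by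
        intro y
        rw [hQ]
        have := pluckerRel_iff_of_dvd hA hα hD x y z w f (x₁ := x₁)
        have h' : (D : ℤ) ∣ x - f * α := ⟨x₁, hx₁⟩
        simp only [hw, hx₁, and_true] at this
        simp only [hw, h', and_true]
        exact this
      simp only [hQ']
      rw [← sum_filter, sum_const, nsmul_eq_mul]
      have hcard := card_filter_dvd_sub hα A (x₁ * z)
      have hph : ph x (A * w) = e (n₁ * x / (A * α : ℕ)) * e (n₂ * w / D) := by
        simp only [ph]
        rw [e_add]
        push_cast
        rw [mul_left_comm, mul_div_mul_left _ _ hA']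
      rw [hph]
      trans (A : ℂ) * (e (n₁ * x / (A * α : ℕ)) * e (n₂ * w / D))
      · congr 2
      · ring
    · simp only [hQ, hw, false_and, and_false, if_false, sum_const_zero, mul_zero]
    · simp only [hQ, hx, and_false, if_false, sum_const_zero]
  unfold boxTuples
  rw [sum_filter, sum_product]
  simp_rw [sum_product]
  have h4 : ∀ x : ℕ, ∑ y ∈ range (A * α), ∑ z ∈ range (A * D), ∑ w ∈ range (A * D),
      (if ∃ t u r : ℤ, PluckerRel (A * α : ℕ) x y t (A * D : ℕ) z w u r then
      ph x w * ((if A ∣ z ∧ A ∣ w then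
        ((range D).filter fun f : ℕ =>
          (D : ℤ) ∣ f * (z / A : ℕ) - coord₂₃ (A * α) (A * D) (x, y, z, w) ∧
          (D : ℤ) ∣ f * (w / A : ℕ) - -(z : ℤ) ∧
          (D : ℤ) ∣ f * α - x).card else 0 : ℕ) : ℂ) else 0) =
      ∑ f ∈ range D, if (D : ℤ) ∣ x - f * α then
        e (n₁ * x / (A * α : ℕ)) *
          (if ((D / Nat.gcd A D * Nat.gcd f (Nat.gcd A D) : ℕ) : ℤ) ∣ n₂ then
            ((A * D * Nat.gcd f (Nat.gcd A D) : ℕ) : ℂ) else 0) else 0 := by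
    intro x
    simp_rw [h1, h2]
    rw [sum_comm_four]
    simp_rw [h3]
    refine sum_congr rfl fun f _ => ?_
    split_ifs with hx
    · simp_rw [← mul_sum]
      rw [sum_phase_plane hD f n₂]
      simp_all
    · simp_rw [← mul_sum]
      rw [sum_phase_plane hD f n₂]
      simp_all
    · simp
  exact (sum_congr rfl fun x _ => h4 x).trans sum_comm

/-! ### Summing over Hermite forms and their scalings -/

/-- The exponential sum over vectors with first coordinate `A * α` in the lattices with basis
`(A, f), (0, D)`, weighted by `φ f`. -/
def lineSum (n : ℤ) (α A D : ℕ) (φ : ℕ → ℂ) : ℂ :=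
  ∑ f ∈ range D, ∑ x ∈ range (A * α), if (D : ℤ) ∣ x - f * α then
    e (n * x / (A * α : ℕ)) * φ f else 0

/-- The weight of a vector of denominators `c * q` in the `v₁₄`-direction. -/
def denomWeight (n : ℤ) (q c : ℕ) : ℂ := if ((q * c : ℕ) : ℤ) ∣ n then (c : ℂ) else 0

theorem powConv_boxSum_eq {a b : ℕ} (ha : a ≠ 0) (hb : b ≠ 0) (n₁ n₂ : ℤ) :
    powConv 1 1 (fun d => (d : ℂ) ^ 1) (boxSum n₁ n₂) a b =
      ∑ A ∈ (Nat.gcd a b).divisors, b * lineSum n₁ (a / A) A (b / A) fun f =>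
        denomWeight n₂ (b / A / Nat.gcd A (b / A)) (Nat.gcd f (Nat.gcd A (b / A))) := by
  classical
  rw [powConv_boxSum ha hb]
  have h1 : ∀ v ∈ boxTuples a b, phase a b n₁ n₂ v *
      ((∑ d ∈ (Nat.gcd (lineContent a b v) (planeContent a b v)).divisors, d : ℕ) : ℂ) =
      ∑ A ∈ (Nat.gcd a b).divisors, phase a b n₁ n₂ v *
        ((if A ∣ v.2.2.1 ∧ A ∣ v.2.2.2 then
        ((range (b / A)).filter fun f : ℕ =>
          ((b / A : ℕ) : ℤ) ∣ f * (v.2.2.1 / A : ℕ) - coord₂₃ a b v ∧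
          ((b / A : ℕ) : ℤ) ∣ f * (v.2.2.2 / A : ℕ) - -(v.2.2.1 : ℤ) ∧
          ((b / A : ℕ) : ℤ) ∣ f * (a / A : ℕ) - v.1).card else 0 : ℕ) : ℂ) := by
    intro v hv
    obtain ⟨-, t, u, r, h⟩ := mem_boxTuples.1 hv
    rw [sum_divisors_content ha hb h, (h.coords ha hb).2.1, Nat.cast_sum, mul_sum]
  rw [sum_congr rfl h1, sum_comm]
  refine sum_congr rfl fun A hA => ?_
  have hA' := Nat.dvd_gcd_iff.1 (Nat.dvd_of_mem_divisors hA)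
  obtain ⟨⟨α, rfl⟩, D, rfl⟩ := hA'
  obtain ⟨hA0, hα⟩ := mul_ne_zero_iff.1 ha
  obtain ⟨-, hD⟩ := mul_ne_zero_iff.1 hb
  rw [Nat.mul_div_cancel_left _ hA0.bot_lt, Nat.mul_div_cancel_left _ hA0.bot_lt,
    sum_box_sublattice hA0 hα hD, lineSum, mul_sum]
  refine sum_congr rfl fun f _ => ?_
  rw [mul_sum]
  refine sum_congr rfl fun x _ => ?_
  rw [denomWeight]
  split_ifs <;> push_cast <;> ring

/-- Multiplying the basis matrix by `k` multiplies `x` by `k` as well; the phase is unchanged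
because its denominator scales too. -/
theorem lineSum_scale {k : ℕ} (hk : k ≠ 0) (n : ℤ) (α A D : ℕ) (φ : ℕ → ℂ) :
    lineSum n α A D φ = lineSum n α (k * A) (k * D) fun f => if k ∣ f then φ (f / k) else 0 := by
  have hk' : (k : ℂ) ≠ 0 := by exact_mod_cast hk
  have hkz : (k : ℤ) ≠ 0 := by exact_mod_cast hk
  unfold lineSum
  have h1 : ∀ f : ℕ, (∑ x ∈ range (k * A * α), if ((k * D : ℕ) : ℤ) ∣ x - f * α then
      e (n * x / (k * A * α : ℕ)) * (if k ∣ f then φ (f / k) else 0) else 0) =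
      if k ∣ f then ∑ x ∈ range (k * (A * α)), (if k ∣ x then
        (if ((k * D : ℕ) : ℤ) ∣ x - f * α then
          e (n * x / (k * A * α : ℕ)) * φ (f / k) else 0) else 0) else 0 := by
    intro f
    split_ifs with hf
    · rw [← mul_assoc]
      refine sum_congr rfl fun x _ => ?_
      by_cases hx : k ∣ x
      · rw [if_pos hx]
      · rw [if_neg hx, if_neg]
        intro h
        refine hx (Int.natCast_dvd_natCast.1 ?_)
        have h2 : (k : ℤ) ∣ x - f * α := (by push_cast; simp : (k : ℤ) ∣ (k * D : ℕ)).trans h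
        exact (dvd_sub_left ((Int.natCast_dvd_natCast.2 hf).mul_right _)).1 h2
    · simp
  simp_rw [h1]
  rw [sum_range_mul_ite_dvd hk]
  refine sum_congr rfl fun f _ => ?_
  rw [sum_range_mul_ite_dvd hk]
  refine sum_congr rfl fun x _ => ?_
  rw [Nat.mul_div_cancel_left _ hk.bot_lt]
  have e1 : ((k * D : ℕ) : ℤ) ∣ (k * x : ℕ) - (k * f : ℕ) * α ↔ (D : ℤ) ∣ x - f * α := by
    push_cast
    rw [mul_assoc, ← mul_sub, mul_dvd_mul_iff_left hkz]
  simp only [e1]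
  congr 3
  push_cast
  rw [mul_left_comm, mul_assoc, mul_div_mul_left _ _ hk']

/-- For given `x`, the congruence `f α ≡ x` modulo `D` has `gcd(α, D)` solutions if this gcd divides
`x`, and none otherwise. What is left is a complete character sum over the multiples of `gcd(α, D)`.
-/
theorem lineSum_one {α A D : ℕ} (hα : α ≠ 0) (hA : A ≠ 0) (hD : D ≠ 0) (n : ℤ) :
    lineSum n α A D (fun _ => 1) =
      if ((A * α / Nat.gcd α D : ℕ) : ℤ) ∣ n then ((A * α : ℕ) : ℂ) else 0 := by
  set δ := Nat.gcd α D with hδ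
  have hδ0 : δ ≠ 0 := Nat.gcd_ne_zero_left hα
  obtain ⟨α', hα'⟩ : δ ∣ α := Nat.gcd_dvd_left _ _
  have hα'0 : α' ≠ 0 := by rintro rfl; exact hα (by simpa using hα')
  have h1 : ∀ x : ℕ, (∑ f ∈ range D, if (D : ℤ) ∣ x - f * α then
      e (n * x / (A * α : ℕ)) * 1 else 0) =
      (if δ ∣ x then e (n * x / (A * α : ℕ)) else 0) * δ := by
    intro x
    have hcount := card_filter_dvd_mul_sub (c := α) hD x
    rw [← sum_filter, sum_const, nsmul_eq_mul]
    simp_rw [dvd_sub_comm (b := (x : ℤ))]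
    rw [hcount, ← hδ]
    simp only [Int.natCast_dvd_natCast]
    split_ifs
    · ring
    · simp
  rw [lineSum, sum_comm]
  simp_rw [h1]
  have hN : A * α = δ * (A * α') := by
    conv_lhs => rw [hα']
    ring
  rw [← sum_mul, hN, sum_range_e_dvd hδ0 (mul_ne_zero hA hα'0),
    Nat.mul_div_cancel_left _ hδ0.bot_lt]
  split_ifs
  · push_cast
    ring
  · simp

/-- Scaling by `k` moves every term to the same pair `(A, D)`, where the weight of `f` becomes a sum
over the divisors `k` of `gcd(f, A, D)`. Exchanging `k` with its complementary divisor leaves a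
weight depending on `k` alone, and the sum over multiples `f` of `k` is a `lineSum` with constant
weight. -/
theorem sum_lineSum_denomWeight {α A D q : ℕ} (hα : α ≠ 0) (hA : A ≠ 0) (hD : D ≠ 0)
    (n₁ n₂ : ℤ) :
    ∑ k ∈ (Nat.gcd A D).divisors, lineSum n₁ α (A / k) (D / k) (fun f =>
      denomWeight n₂ q (Nat.gcd f (Nat.gcd A D / k))) =
    ∑ k ∈ (Nat.gcd A D).divisors, denomWeight n₂ q k *
      (if ((A / k * α / Nat.gcd α (D / k) : ℕ) : ℤ) ∣ n₁ then ((A / k * α : ℕ) : ℂ) else 0) := by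
  set g := Nat.gcd A D with hg
  have hg0 : g ≠ 0 := Nat.gcd_ne_zero_left hA
  have hscale : ∀ (k : ℕ) (_ : k ∈ g.divisors) (φ : ℕ → ℂ),
      lineSum n₁ α (A / k) (D / k) φ =
        lineSum n₁ α A D fun f => if k ∣ f then φ (f / k) else 0 := by
    intro k hk φ
    have hkg := Nat.dvd_of_mem_divisors hk
    have hk0 : k ≠ 0 := fun h0 => hg0 (by rw [h0] at hkg; exact zero_dvd_iff.1 hkg)
    rw [lineSum_scale hk0, Nat.mul_div_cancel' (hkg.trans (Nat.gcd_dvd_left _ _)),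
      Nat.mul_div_cancel' (hkg.trans (Nat.gcd_dvd_right _ _))]
  have hsum : ∀ (ψ : ℕ → ℕ → ℂ), ∑ k ∈ g.divisors, lineSum n₁ α A D (ψ k) =
      lineSum n₁ α A D fun f => ∑ k ∈ g.divisors, ψ k f := by
    intro ψ
    unfold lineSum
    rw [sum_comm]
    refine sum_congr rfl fun f _ => ?_
    rw [sum_comm]
    refine sum_congr rfl fun x _ => ?_
    split_ifs
    · rw [mul_sum]
    · simp
  have hone : ∀ k ∈ g.divisors, denomWeight n₂ q k *
      (if ((A / k * α / Nat.gcd α (D / k) : ℕ) : ℤ) ∣ n₁ then ((A / k * α : ℕ) : ℂ) else 0) =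
      lineSum n₁ α A D fun f => if k ∣ f then denomWeight n₂ q k else 0 := by
    intro k hk
    have hkg := Nat.dvd_of_mem_divisors hk
    have hk0 : k ≠ 0 := fun h0 => hg0 (by rw [h0] at hkg; exact zero_dvd_iff.1 hkg)
    have hA' : A / k ≠ 0 :=
      (Nat.div_pos (Nat.le_of_dvd hA.bot_lt (hkg.trans (Nat.gcd_dvd_left _ _))) hk0.bot_lt).ne'
    have hD' : D / k ≠ 0 :=
      (Nat.div_pos (Nat.le_of_dvd hD.bot_lt (hkg.trans (Nat.gcd_dvd_right _ _))) hk0.bot_lt).ne'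
    rw [← lineSum_one hα hA' hD', hscale k hk]
    unfold lineSum
    simp_rw [mul_sum]
    refine sum_congr rfl fun f _ => sum_congr rfl fun x _ => ?_
    split_ifs <;> simp [mul_comm]
  rw [sum_congr rfl fun k hk => hscale k hk _, sum_congr rfl hone, hsum, hsum]
  congr 1
  funext f
  have hset : g.divisors.filter (fun k => k ∣ f) = (Nat.gcd f g).divisors := by
    ext k
    simp [Nat.dvd_gcd_iff, hg0, and_comm]
  -- `Nat.sum_div_divisors` replaces `k` by `gcd(f, g) / k`.
  rw [← sum_filter, ← sum_filter, hset,
    ← Nat.sum_div_divisors (Nat.gcd f g) (denomWeight n₂ q)]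
  refine sum_congr rfl fun k hk => ?_
  have hk' := Nat.dvd_of_mem_divisors hk
  rw [Nat.gcd_div (hk'.trans (Nat.gcd_dvd_left _ _)) (hk'.trans (Nat.gcd_dvd_right _ _))]

/-- The coefficients of the Dirichlet series of `expSum` multiplied by the zeta factors. -/
def reducedCoeff (n₁ n₂ : ℤ) (a b : ℕ) : ℂ :=
  ∑ A ∈ (Nat.gcd a b).divisors, ∑ k ∈ (Nat.gcd A (b / A)).divisors,
    b * (denomWeight n₂ (b / A / Nat.gcd A (b / A)) k *
      (if ((A / k * (a / A) / Nat.gcd (a / A) (b / A / k) : ℕ) : ℤ) ∣ n₁ then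
        ((A / k * (a / A) : ℕ) : ℂ) else 0))

/-- Passing from `(a, b)` to `(k a, k² b)` corresponds to passing from `(A, D)` to `(k A, k D)` with
`α` unchanged, so the convolution ranges over all `k` dividing `gcd(A, D)`. -/
theorem powConv_powConv_boxSum {a b : ℕ} (ha : a ≠ 0) (hb : b ≠ 0) (n₁ n₂ : ℤ) :
    powConv 1 2 (fun d => (d : ℂ) ^ 2) (powConv 1 1 (fun d => (d : ℂ) ^ 1) (boxSum n₁ n₂)) a b =
      reducedCoeff n₁ n₂ a b := by
  rw [powConv_congr (by simp) (fun a b ha hb => powConv_boxSum_eq ha hb n₁ n₂) ha hb, powConv,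
    reducedCoeff]
  simp_rw [mul_sum]
  have h1 : ∀ A ∈ (Nat.gcd a b).divisors, (∑ k ∈ (Nat.gcd A (b / A)).divisors,
      b * (denomWeight n₂ (b / A / Nat.gcd A (b / A)) k *
      (if ((A / k * (a / A) / Nat.gcd (a / A) (b / A / k) : ℕ) : ℤ) ∣ n₁ then
        ((A / k * (a / A) : ℕ) : ℂ) else 0))) =
      ∑ k ∈ (Nat.gcd A (b / A)).divisors, b * lineSum n₁ (a / A) (A / k) (b / A / k) fun f =>
        denomWeight n₂ (b / A / Nat.gcd A (b / A)) (Nat.gcd f (Nat.gcd A (b / A) / k)) := by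
    intro A hA
    obtain ⟨⟨α, rfl⟩, D, rfl⟩ := Nat.dvd_gcd_iff.1 (Nat.dvd_of_mem_divisors hA)
    obtain ⟨hA0, hα⟩ := mul_ne_zero_iff.1 ha
    obtain ⟨-, hD⟩ := mul_ne_zero_iff.1 hb
    rw [Nat.mul_div_cancel_left _ hA0.bot_lt, Nat.mul_div_cancel_left _ hA0.bot_lt,
      ← mul_sum, ← mul_sum, sum_lineSum_denomWeight hα hA0 hD]
  rw [sum_congr rfl h1, sum_sigma', sum_sigma']
  refine sum_bij' (fun q _ => ⟨q.1 * q.2, q.1⟩) (fun q _ => ⟨q.2, q.1 / q.2⟩) ?_ ?_ ?_ ?_ ?_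
  · rintro ⟨k, A⟩ h
    simp only [mem_sigma] at h ⊢
    rw [mem_commonPowDivisors (by simp) ha hb, pow_one, Nat.mem_divisors, Nat.dvd_gcd_iff] at h
    obtain ⟨⟨⟨a, rfl⟩, b, rfl⟩, ⟨h1, h2⟩, -⟩ := h
    obtain ⟨hk, ha'⟩ := mul_ne_zero_iff.1 ha
    obtain ⟨hk2, hb'⟩ := mul_ne_zero_iff.1 hb
    rw [Nat.mul_div_cancel_left _ hk.bot_lt] at h1
    rw [Nat.mul_div_cancel_left _ hk2.bot_lt] at h2
    obtain ⟨α, rfl⟩ := h1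
    obtain ⟨D, rfl⟩ := h2
    obtain ⟨hA, hα⟩ := mul_ne_zero_iff.1 ha'
    obtain ⟨-, hD⟩ := mul_ne_zero_iff.1 hb'
    have e2 : k ^ 2 * (A * D) / (k * A) = k * D := by
      rw [show k ^ 2 * (A * D) = k * A * (k * D) by ring]
      exact Nat.mul_div_cancel_left _ (mul_ne_zero hk hA).bot_lt
    rw [e2, Nat.mem_divisors, Nat.mem_divisors, Nat.dvd_gcd_iff, Nat.dvd_gcd_iff]
    refine ⟨⟨⟨⟨α, by ring⟩, ⟨k * D, by ring⟩⟩, ?_⟩, ⟨⟨A, rfl⟩, ⟨D, rfl⟩⟩, ?_⟩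
    · exact Nat.gcd_ne_zero_left ha
    · exact Nat.gcd_ne_zero_left (mul_ne_zero hk hA)
  · rintro ⟨A, k⟩ h
    simp only [mem_sigma] at h ⊢
    rw [Nat.mem_divisors, Nat.mem_divisors, Nat.dvd_gcd_iff, Nat.dvd_gcd_iff] at h
    obtain ⟨⟨⟨⟨α, rfl⟩, D, rfl⟩, -⟩, ⟨⟨A, rfl⟩, hD⟩, -⟩ := h
    obtain ⟨hkA, hα⟩ := mul_ne_zero_iff.1 ha
    obtain ⟨hk, hA⟩ := mul_ne_zero_iff.1 hkA
    rw [Nat.mul_div_cancel_left _ hkA.bot_lt] at hD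
    obtain ⟨D, rfl⟩ := hD
    rw [mem_commonPowDivisors (by simp) ha hb, Nat.mul_div_cancel_left _ hk.bot_lt, pow_one,
      Nat.mem_divisors, Nat.dvd_gcd_iff]
    have e1 : k * A * α / k = A * α := by
      rw [mul_assoc]
      exact Nat.mul_div_cancel_left _ hk.bot_lt
    have e2 : k * A * (k * D) / k ^ 2 = A * D := by
      rw [show k * A * (k * D) = k ^ 2 * (A * D) by ring]
      exact Nat.mul_div_cancel_left _ (pow_ne_zero 2 hk).bot_lt
    rw [e1, e2]
    exact ⟨⟨⟨A * α, by ring⟩, ⟨A * D, by ring⟩⟩, ⟨⟨α, rfl⟩, ⟨D, rfl⟩⟩,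
      Nat.gcd_ne_zero_left (mul_ne_zero hA hα)⟩
  · rintro ⟨k, A⟩ h
    simp only [mem_sigma] at h
    rw [mem_commonPowDivisors (by simp) ha hb, pow_one] at h
    have hk : k ≠ 0 := fun h0 => ha (by have := h.1.1; rwa [h0, zero_dvd_iff] at this)
    simp [Nat.mul_div_cancel_left _ hk.bot_lt]
  · rintro ⟨A, k⟩ h
    simp only [mem_sigma] at h
    have hk := (Nat.dvd_of_mem_divisors h.2).trans (Nat.gcd_dvd_left _ _)
    simp [Nat.mul_div_cancel' hk]
  · rintro ⟨k, A⟩ h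
    simp only [mem_sigma] at h ⊢
    rw [mem_commonPowDivisors (by simp) ha hb, pow_one, Nat.mem_divisors, Nat.dvd_gcd_iff] at h
    obtain ⟨⟨⟨a, rfl⟩, b, rfl⟩, ⟨h1, h2⟩, -⟩ := h
    obtain ⟨hk, ha'⟩ := mul_ne_zero_iff.1 ha
    obtain ⟨hk2, hb'⟩ := mul_ne_zero_iff.1 hb
    rw [Nat.mul_div_cancel_left _ hk.bot_lt] at h1
    rw [Nat.mul_div_cancel_left _ hk2.bot_lt] at h2
    obtain ⟨α, rfl⟩ := h1
    obtain ⟨D, rfl⟩ := h2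
    obtain ⟨hA, hα⟩ := mul_ne_zero_iff.1 ha'
    obtain ⟨-, hD⟩ := mul_ne_zero_iff.1 hb'
    have e2 : k ^ 2 * (A * D) / (k * A) = k * D := by
      rw [show k ^ 2 * (A * D) = k * A * (k * D) by ring]
      exact Nat.mul_div_cancel_left _ (mul_ne_zero hk hA).bot_lt
    have e3 : k * (A * α) / (k * A) = α := by
      rw [← mul_assoc]
      exact Nat.mul_div_cancel_left _ (mul_ne_zero hk hA).bot_lt
    rw [e2, e3, pow_one, Nat.mul_div_cancel_left _ hk.bot_lt, Nat.mul_div_cancel_left _ hk2.bot_lt,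
      Nat.mul_div_cancel_left _ hA.bot_lt, Nat.mul_div_cancel_left _ hA.bot_lt,
      Nat.mul_div_cancel_left _ hk.bot_lt, Nat.mul_div_cancel_left _ hk.bot_lt, Nat.gcd_mul_left,
      Nat.mul_div_mul_left _ _ hk.bot_lt, Nat.mul_div_cancel_left _ hk.bot_lt]
    push_cast
    ring

/-! ### The quadruple series -/

/-- The term of index `(c, A, D, α)` of the reduced Dirichlet series. -/
def quadTerm (ν₁ ν₂ : ℂ) (n₁ n₂ : ℤ) (q : ℕ+ × ℕ+ × ℕ+ × ℕ+) : ℂ :=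
  ((q.1 : ℕ) : ℂ) ^ (3 - ν₁ - 2 * ν₂) * ((q.2.1 : ℕ) : ℂ) ^ (2 - ν₁ - ν₂) *
    ((q.2.2.1 : ℕ) : ℂ) ^ (1 - ν₂) * ((q.2.2.2 : ℕ) : ℂ) ^ (1 - ν₁) *
    (if ((q.2.1 * q.2.2.2 / Nat.gcd q.2.2.2 q.2.2.1 : ℕ) : ℤ) ∣ n₁ then 1 else 0) *
    (if ((q.2.2.1 / Nat.gcd q.2.1 q.2.2.1 * q.1 : ℕ) : ℤ) ∣ n₂ then 1 else 0)

theorem natCast_mul_cpow (m n : ℕ) (w : ℂ) :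
    ((m * n : ℕ) : ℂ) ^ w = (m : ℂ) ^ w * (n : ℂ) ^ w := by
  rw [Nat.cast_mul, Complex.natCast_mul_natCast_cpow]

theorem hasSum_reducedCoeff {ν₁ ν₂ : ℂ} {n₁ n₂ : ℤ} {s : ℂ}
    (h : HasSum (quadTerm ν₁ ν₂ n₁ n₂) s) :
    HasSum (dirichletWeight ν₁ ν₂ (reducedCoeff n₁ n₂)) s := by
  -- In `reducedCoeff` the divisor `A` has a divisor `k` that also divides `b / A`. Writing `k = c`,
  -- the two become `c A` and `c D`, whence `a = c A α` and `b = c A · c D`.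
  let π : ℕ+ × ℕ+ × ℕ+ × ℕ+ → ℕ+ × ℕ+ := fun q =>
    (q.1 * q.2.1 * q.2.2.2, q.1 * q.2.1 * (q.1 * q.2.2.1))
  let T : ℕ+ × ℕ+ → Finset (ℕ+ × ℕ+ × ℕ+ × ℕ+) := fun v =>
    ((Icc 1 v.1) ×ˢ (Icc 1 v.1) ×ˢ (Icc 1 v.2) ×ˢ (Icc 1 v.1)).filter (fun q => π q = v)
  have hT : ∀ v q, q ∈ T v ↔ π q = v := by
    rintro v ⟨c, A, D, α⟩
    simp only [T, mem_filter, mem_product, mem_Icc, one_le, true_and, and_iff_right_iff_imp]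
    rintro rfl
    have hle : ∀ m n : ℕ+, n ≤ m * n := fun m n => by simp
    have hle' : ∀ m n : ℕ+, n ≤ n * m := fun m n => by rw [mul_comm]; exact hle m n
    exact ⟨(hle' _ _).trans (hle' _ _), (hle _ _).trans (hle' _ _), (hle _ _).trans (hle _ _),
      hle _ _⟩
  refine hasSum_of_fiber h π _ T hT ?_
  rintro ⟨a, b⟩
  unfold dirichletWeight reducedCoeff
  simp_rw [mul_sum]
  rw [sum_sigma']
  symm
  refine sum_bij (fun q _ => ⟨q.1 * q.2.1, q.1⟩) ?_ ?_ ?_ ?_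
  · rintro ⟨c, A, D, α⟩ h
    rw [hT] at h
    simp only [π, Prod.mk.injEq] at h
    obtain ⟨rfl, rfl⟩ := h
    simp only [mem_sigma, PNat.mul_coe]
    rw [Nat.mul_div_cancel_left _ (by positivity), Nat.mem_divisors, Nat.mem_divisors,
      Nat.dvd_gcd_iff, Nat.dvd_gcd_iff]
    exact ⟨⟨⟨⟨α, rfl⟩, ⟨c * D, rfl⟩⟩, Nat.gcd_ne_zero_left (by positivity)⟩,
      ⟨⟨A, rfl⟩, ⟨D, rfl⟩⟩, Nat.gcd_ne_zero_left (by positivity)⟩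
  · rintro ⟨c, A, D, α⟩ h ⟨c', A', D', α'⟩ h' heq
    rw [hT] at h h'
    simp only [π, Prod.mk.injEq] at h h'
    simp only [Sigma.mk.injEq, heq_eq_eq] at heq
    obtain ⟨h1, h2⟩ := heq
    obtain rfl : c = c' := PNat.coe_injective h2
    obtain rfl : A = A' := PNat.coe_injective (Nat.eq_of_mul_eq_mul_left c.pos h1)
    obtain ⟨rfl, rfl⟩ := h
    simp only [mul_right_inj] at h'
    rw [h'.1, h'.2]
  · rintro ⟨A, k⟩ hq
    simp only [mem_sigma] at hq
    rw [Nat.mem_divisors, Nat.mem_divisors, Nat.dvd_gcd_iff, Nat.dvd_gcd_iff] at hq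
    obtain ⟨⟨⟨⟨α, ha⟩, D, hb⟩, -⟩, ⟨⟨A, rfl⟩, hD⟩, -⟩ := hq
    obtain ⟨hkA, hα⟩ := mul_ne_zero_iff.1 (ha ▸ PNat.ne_zero a)
    obtain ⟨-, hD0⟩ := mul_ne_zero_iff.1 (hb ▸ PNat.ne_zero b)
    obtain ⟨hk, hA⟩ := mul_ne_zero_iff.1 hkA
    rw [hb, Nat.mul_div_cancel_left _ hkA.bot_lt] at hD
    obtain ⟨D, rfl⟩ := hD
    obtain ⟨-, hD⟩ := mul_ne_zero_iff.1 hD0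
    lift k to ℕ+ using hk.bot_lt
    lift A to ℕ+ using hA.bot_lt
    lift D to ℕ+ using hD.bot_lt
    lift α to ℕ+ using hα.bot_lt
    refine ⟨(k, A, D, α), ?_, rfl⟩
    rw [hT]
    exact Prod.ext (PNat.coe_injective (by simp [π, ha])) (PNat.coe_injective (by simp [π, hb]))
  · rintro ⟨c, A, D, α⟩ h
    rw [hT] at h
    simp only [π, Prod.mk.injEq] at h
    obtain ⟨rfl, rfl⟩ := h
    have hc : ((c : ℕ) : ℂ) ≠ 0 := by simp
    have hA : ((A : ℕ) : ℂ) ≠ 0 := by simp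
    have hD : ((D : ℕ) : ℂ) ≠ 0 := by simp
    have hα : ((α : ℕ) : ℂ) ≠ 0 := by simp
    have e1 : (c * A * (c * D) : ℕ) / (c * A) = c * D :=
      Nat.mul_div_cancel_left _ (by positivity)
    have e2 : (c * A * α : ℕ) / (c * A) = α := Nat.mul_div_cancel_left _ (by positivity)
    have e3 : (c * D : ℕ) / c = D := Nat.mul_div_cancel_left _ c.pos
    have e4 : (c * A : ℕ) / c = A := Nat.mul_div_cancel_left _ c.pos
    have e5 : (c * D : ℕ) / (c * Nat.gcd A D) = D / Nat.gcd A D := Nat.mul_div_mul_left _ _ c.pos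
    simp only [PNat.mul_coe, quadTerm, e1, e2, e3, e4, e5, Nat.gcd_mul_left, denomWeight]
    split_ifs with h1 h2
    · simp only [natCast_mul_cpow, mul_one]
      rw [show 3 - ν₁ - 2 * ν₂ = -ν₁ + -ν₂ + -ν₂ + (3 : ℕ) by push_cast; ring,
        show 2 - ν₁ - ν₂ = -ν₁ + -ν₂ + (2 : ℕ) by push_cast; ring,
        show 1 - ν₂ = -ν₂ + (1 : ℕ) by push_cast; ring,
        show 1 - ν₁ = -ν₁ + (1 : ℕ) by push_cast; ring]
      simp only [Complex.cpow_add _ _ hc, Complex.cpow_add _ _ hA, Complex.cpow_add _ _ hD,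
        Complex.cpow_add _ _ hα, Complex.cpow_natCast, Nat.cast_mul]
      ring
    all_goals simp

/-- The four convolutions are peeled off from the outside, each contributing one zeta value in its
half-plane of absolute convergence, where it does not vanish. -/
theorem summable_and_tsum_expSum {ν₁ ν₂ : ℂ} {n₁ n₂ : ℤ} {s : ℂ} (h₁ : 1 < ν₁.re)
    (h₂ : 1 < ν₂.re) (h : HasSum (quadTerm ν₁ ν₂ n₁ n₂) s) :
    Summable (dirichletTerm ν₁ ν₂ n₁ n₂) ∧ ramanujan ν₁ ν₂ n₁ n₂ = s / zetaDenom ν₁ ν₂ := by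
  have hcongr : ∀ {f g : ℕ → ℕ → ℂ}, (∀ a b, a ≠ 0 → b ≠ 0 → f a b = g a b) →
      dirichletWeight ν₁ ν₂ f = dirichletWeight ν₁ ν₂ g := fun hfg => by
    funext v
    rw [dirichletWeight, dirichletWeight, hfg _ _ (PNat.ne_zero _) (PNat.ne_zero _)]
  have h4 := hasSum_reducedCoeff h
  rw [← hcongr fun a b ha hb => powConv_powConv_boxSum ha hb n₁ n₂] at h4
  obtain ⟨s3, t3⟩ := summable_and_tsum_powConv (by simp) (w := ν₁ + 2 * ν₂ - 2) (by push_cast; ring)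
    (by simp; linarith) h4.summable
  obtain ⟨s2, t2⟩ := summable_and_tsum_powConv (by simp) (w := ν₁ + ν₂ - 1) (by push_cast; ring)
    (by simp; linarith) s3
  rw [← hcongr fun a b ha hb => powConv_expSum ha hb n₁ n₂] at s2 t2
  obtain ⟨s1, t1⟩ := summable_and_tsum_powConv (by simp) (w := ν₂) (by push_cast; ring)
    h₂ s2
  obtain ⟨s0, t0⟩ := summable_and_tsum_powConv (by simp) (w := ν₁) (by push_cast; ring)
    h₁ s1
  refine ⟨s0, ?_⟩
  have hz : zetaDenom ν₁ ν₂ ≠ 0 := by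
    unfold zetaDenom
    refine mul_ne_zero (mul_ne_zero (mul_ne_zero ?_ ?_) ?_) ?_ <;>
      refine riemannZeta_ne_zero_of_one_lt_re ?_
    · exact h₁
    · exact h₂
    · simp; linarith
    · simp; linarith
  rw [eq_div_iff hz, ← h4.tsum_eq, t3, t2, t1, t0, zetaDenom]
  change (∑' v, dirichletWeight ν₁ ν₂ (fun a b => expSum a b n₁ n₂) v) * _ = _
  ring

/-! ### Evaluation when at least one argument is zero -/

theorem hasSum_pnat_cpow {w : ℂ} (hw : w.re < -1) :
    HasSum (fun d : ℕ+ => ((d : ℕ) : ℂ) ^ w) (riemannZeta (-w)) := by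
  have hre : 1 < (-w).re := by simp; linarith
  have hs : Summable fun n : ℕ => 1 / (n : ℂ) ^ (-w) := Complex.summable_one_div_nat_cpow.2 hre
  have hs' : Summable fun d : ℕ+ => 1 / ((d : ℕ) : ℂ) ^ (-w) :=
    hs.comp_injective PNat.coe_injective
  have hz : ∑' d : ℕ+, 1 / ((d : ℕ) : ℂ) ^ (-w) = riemannZeta (-w) := by
    rw [zeta_eq_tsum_one_div_nat_add_one_cpow hre,
      tsum_pnat_eq_tsum_succ (f := fun n : ℕ => 1 / (n : ℂ) ^ (-w))]
    simp
  have h := hs'.hasSum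
  rw [hz] at h
  simpa [Complex.cpow_neg] using h

theorem hasSum_pnat_divisors {n : ℤ} (hn : n ≠ 0) (w : ℂ) :
    HasSum (fun d : ℕ+ => ((d : ℕ) : ℂ) ^ w * (if ((d : ℕ) : ℤ) ∣ n then 1 else 0))
      (sigmaOne w n) := by
  let g : ℕ → ℂ := fun d => if d ∈ n.natAbs.divisors then (d : ℂ) ^ w else 0
  have h1 : HasSum g (sigmaOne w n) := by
    have h : HasSum g (∑ d ∈ n.natAbs.divisors, g d) :=
      hasSum_sum_of_ne_finset_zero fun d hd => if_neg hd
    have e1 : ∑ d ∈ n.natAbs.divisors, g d = sigmaOne w n :=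
      sum_congr rfl fun d hd => if_pos hd
    rwa [e1] at h
  rw [← PNat.coe_injective.hasSum_iff] at h1
  · convert h1 using 2 with d
    simp only [Function.comp, g, Nat.mem_divisors, Int.natAbs_ne_zero, ne_eq, hn,
      not_false_eq_true, and_true, ← Int.natCast_dvd, mul_ite, mul_one, mul_zero]
  · intro d hd
    refine if_neg fun h => hd ?_
    exact ⟨⟨d, Nat.pos_of_mem_divisors h⟩, rfl⟩

/-- The involution `(m, y, z) ↦ (gcd(y, z), m y / gcd(y, z), m z / gcd(y, z))`. -/
def gcdSwap (q : ℕ+ × ℕ+ × ℕ+) : ℕ+ × ℕ+ × ℕ+ :=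
  (PNat.gcd q.2.1 q.2.2, q.1 * PNat.divExact q.2.1 (PNat.gcd q.2.1 q.2.2),
    q.1 * PNat.divExact q.2.2 (PNat.gcd q.2.1 q.2.2))

/-- In the coordinates `(m, g y, g z)` with `y`, `z` coprime, the map just exchanges `m` and `g`;
this makes the involution evident. -/
theorem gcdSwap_mk {g y z : ℕ+} (m : ℕ+) (h : Nat.Coprime y z) :
    gcdSwap (m, g * y, g * z) = (g, m * y, m * z) := by
  have hg : PNat.gcd (g * y) (g * z) = g := PNat.coe_injective (by
    rw [PNat.gcd_coe, PNat.mul_coe, PNat.mul_coe, Nat.gcd_mul_left, h.gcd_eq_one, mul_one])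
  have hdiv : ∀ w : ℕ+, PNat.divExact (g * w) g = w := fun w =>
    mul_left_cancel (PNat.mul_div_exact (dvd_mul_right g w))
  rw [gcdSwap, hg, hdiv, hdiv]

theorem exists_gcd_coprime (y z : ℕ+) :
    ∃ g y' z' : ℕ+, y = g * y' ∧ z = g * z' ∧ Nat.Coprime y' z' := by
  obtain ⟨g, y', z', hg, hc, hy, hz⟩ := Nat.exists_coprime' (Nat.gcd_pos_of_pos_left z y.pos)
  have hy' : y' ≠ 0 := fun h => y.ne_zero (by rw [hy, h, zero_mul])
  have hz' : z' ≠ 0 := fun h => z.ne_zero (by rw [hz, h, zero_mul])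
  lift g to ℕ+ using hg
  lift y' to ℕ+ using hy'.bot_lt
  lift z' to ℕ+ using hz'.bot_lt
  exact ⟨g, y', z', PNat.coe_injective (by simp [hy, mul_comm]),
    PNat.coe_injective (by simp [hz, mul_comm]), hc⟩

theorem gcdSwap_involutive : Function.Involutive gcdSwap := by
  rintro ⟨m, y, z⟩
  obtain ⟨g, y, z, rfl, rfl, h⟩ := exists_gcd_coprime y z
  rw [gcdSwap_mk m h, gcdSwap_mk g h]

/-- The Hecke-type identity for a triple sum with a divisibility condition. -/
theorem hasSum_triple {n : ℤ} (hn : n ≠ 0) {s x : ℂ} (hs : s.re < -1) (hx : (s + x).re < -1) :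
    HasSum (fun q : ℕ+ × ℕ+ × ℕ+ => ((q.1 : ℕ) : ℂ) ^ (s + x) * ((q.2.1 : ℕ) : ℂ) ^ s *
      ((q.2.2 : ℕ) : ℂ) ^ x *
        (if ((q.1 * q.2.2 / Nat.gcd q.2.1 q.2.2 : ℕ) : ℤ) ∣ n then 1 else 0))
      (riemannZeta (-(s + x)) * (riemannZeta (-s) * sigmaOne x n)) := by
  have h := hasSum_mul_prod (hasSum_pnat_cpow hx)
    (hasSum_mul_prod (hasSum_pnat_cpow hs) (hasSum_pnat_divisors hn x))
  -- The monomial is symmetric in `m` and `g`, while the condition that the third coordinate divides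
  -- `n` is carried to the condition `m z / gcd(y, z) ∣ n` of the statement.
  rw [← (gcdSwap_involutive.toPerm).hasSum_iff] at h
  convert h using 2 with q
  obtain ⟨m, y, z⟩ := q
  obtain ⟨g, y, z, rfl, rfl, hc⟩ := exists_gcd_coprime y z
  simp only [Function.comp, Function.Involutive.coe_toPerm, gcdSwap_mk m hc, PNat.mul_coe]
  have e1 : (m * (g * z) : ℕ) / Nat.gcd (g * y) (g * z) = m * z := by
    rw [Nat.gcd_mul_left, hc.gcd_eq_one, mul_one, mul_left_comm]
    exact Nat.mul_div_cancel_left _ g.pos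
  simp only [e1, natCast_mul_cpow]
  rw [Complex.cpow_add _ _ (by simp), Complex.cpow_add _ _ (by simp)]
  ring

theorem hasSum_quadTerm_zero_zero {ν₁ ν₂ : ℂ} (h₁ : 2 < ν₁.re) (h₂ : 2 < ν₂.re) :
    HasSum (quadTerm ν₁ ν₂ 0 0) (riemannZeta (ν₁ - 1) * riemannZeta (ν₂ - 1) *
      riemannZeta (ν₁ + ν₂ - 2) * riemannZeta (ν₁ + 2 * ν₂ - 3)) := by
  have h := hasSum_mul_prod (hasSum_pnat_cpow (w := 3 - ν₁ - 2 * ν₂) (by simp; linarith))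
    (hasSum_mul_prod (hasSum_pnat_cpow (w := 2 - ν₁ - ν₂) (by simp; linarith))
      (hasSum_mul_prod (hasSum_pnat_cpow (w := 1 - ν₂) (by simp; linarith))
        (hasSum_pnat_cpow (w := 1 - ν₁) (by simp; linarith))))
  convert h using 1
  · funext q
    simp [quadTerm, mul_assoc]
  · ring_nf

theorem hasSum_quadTerm_left {ν₁ ν₂ : ℂ} {n₁ : ℤ} (hn : n₁ ≠ 0) (h₁ : 1 < ν₁.re)
    (h₂ : 2 < ν₂.re) :
    HasSum (quadTerm ν₁ ν₂ n₁ 0) (sigmaOne (1 - ν₁) n₁ * riemannZeta (ν₂ - 1) *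
      riemannZeta (ν₁ + ν₂ - 2) * riemannZeta (ν₁ + 2 * ν₂ - 3)) := by
  have h := hasSum_mul_prod (hasSum_pnat_cpow (w := 3 - ν₁ - 2 * ν₂) (by simp; linarith))
    (hasSum_triple hn (s := 1 - ν₂) (x := 1 - ν₁) (by simp; linarith) (by simp; linarith))
  convert h using 1
  · funext q
    simp only [quadTerm, dvd_zero, if_true, mul_one, Nat.gcd_comm (q.2.2.2 : ℕ)]
    rw [show 1 - ν₂ + (1 - ν₁) = 2 - ν₁ - ν₂ by ring]
    ring
  · ring_nf

theorem hasSum_quadTerm_right {ν₁ ν₂ : ℂ} {n₂ : ℤ} (hn : n₂ ≠ 0) (h₁ : 2 < ν₁.re)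
    (h₂ : 1 < ν₂.re) :
    HasSum (quadTerm ν₁ ν₂ 0 n₂) (sigmaOne (1 - ν₂) n₂ * riemannZeta (ν₁ - 1) *
      riemannZeta (ν₁ + ν₂ - 2) * riemannZeta (ν₁ + 2 * ν₂ - 3)) := by
  have h := hasSum_mul_prod (hasSum_triple hn (s := 2 - ν₁ - ν₂) (x := 1 - ν₂)
    (by simp; linarith) (by simp; linarith))
    (hasSum_pnat_cpow (w := 1 - ν₁) (by simp; linarith))
  let σ : ℕ+ × ℕ+ × ℕ+ × ℕ+ ≃ (ℕ+ × ℕ+ × ℕ+) × ℕ+ :=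
    ⟨fun q => ((q.1, q.2.1, q.2.2.1), q.2.2.2), fun q => (q.1.1, q.1.2.1, q.1.2.2, q.2),
      fun _ => rfl, fun _ => rfl⟩
  rw [← σ.hasSum_iff] at h
  convert h using 1
  · funext q
    obtain ⟨c, A, D, α⟩ := q
    have e1 : (D / Nat.gcd A D * c : ℕ) = c * D / Nat.gcd A D := by
      rw [mul_comm, Nat.mul_div_assoc _ (Nat.gcd_dvd_right _ _)]
    simp only [quadTerm, dvd_zero, if_true, mul_one, Function.comp, σ, Equiv.coe_fn_mk, e1]
    rw [show 2 - ν₁ - ν₂ + (1 - ν₂) = 3 - ν₁ - 2 * ν₂ by ring]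
    ring
  · ring_nf

/-! ### Nonzero arguments: a finite multiplicative sum -/

/-- The divisor sum `σ_w(n)` of a natural number. -/
def sigmaNat (w : ℂ) (n : ℕ) : ℂ := ∑ d ∈ n.divisors, (d : ℂ) ^ w

/-- The value of the reduced Dirichlet series at nonzero arguments, as a finite sum. -/
def finiteSum (x s : ℂ) (n m : ℕ) : ℂ :=
  ∑ A ∈ n.divisors, ∑ D ∈ (m * A).divisors, (A : ℂ) ^ (s + x) * (D : ℂ) ^ s *
    (sigmaNat x (n * D / A) * sigmaNat (s + x + s) (m * Nat.gcd A D / D))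

/-- This and the next lemma untangle the two conditions into successive ones: first `A`, then `D`
given `A`, then `α` and `c` independently given both. -/
theorem mul_div_gcd_dvd_iff {A α D n : ℕ} (hA : A ≠ 0) (hα : α ≠ 0) :
    A * α / Nat.gcd α D ∣ n ↔ A ∣ n ∧ α ∣ n * D / A := by
  obtain ⟨g, a, d, hg, hc, rfl, rfl⟩ := Nat.exists_coprime' (Nat.gcd_pos_of_pos_left D hα.bot_lt)
  rw [Nat.gcd_mul_right, hc.gcd_eq_one, one_mul, ← mul_assoc, Nat.mul_div_cancel _ hg]
  have key : ∀ k, a * g ∣ A * k * (d * g) / A ↔ a ∣ k := fun k => by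
    rw [mul_assoc, Nat.mul_div_cancel_left _ hA.bot_lt, ← mul_assoc,
      Nat.mul_dvd_mul_iff_right hg]
    exact hc.dvd_mul_right
  constructor
  · intro h
    obtain ⟨k, rfl⟩ := (dvd_mul_right A a).trans h
    exact ⟨dvd_mul_right _ _, (key k).2 ((Nat.mul_dvd_mul_iff_left hA.bot_lt).1 h)⟩
  · rintro ⟨⟨k, rfl⟩, h⟩
    exact mul_dvd_mul_left A ((key k).1 h)

theorem div_gcd_mul_dvd_iff {A D c m : ℕ} (hD : D ≠ 0) :
    D / Nat.gcd A D * c ∣ m ↔ D ∣ m * A ∧ c ∣ m * Nat.gcd A D / D := by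
  obtain ⟨g, a, d, hg, hc, rfl, rfl⟩ := Nat.exists_coprime' (Nat.gcd_pos_of_pos_right A hD.bot_lt)
  have hd : d ≠ 0 := (mul_ne_zero_iff.1 hD).1
  rw [Nat.gcd_mul_right, hc.gcd_eq_one, one_mul, Nat.mul_div_cancel _ hg,
    Nat.mul_div_mul_right _ _ hg, ← mul_assoc, Nat.mul_dvd_mul_iff_right hg,
    hc.symm.dvd_mul_right]
  constructor
  · intro h
    obtain ⟨k, rfl⟩ := (dvd_mul_right d c).trans h
    rw [Nat.mul_div_cancel_left _ hd.bot_lt]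
    exact ⟨dvd_mul_right _ _, (Nat.mul_dvd_mul_iff_left hd.bot_lt).1 h⟩
  · rintro ⟨⟨k, rfl⟩, h⟩
    rw [Nat.mul_div_cancel_left _ hd.bot_lt] at h
    exact mul_dvd_mul_left d h

/-- The untangled conditions bound all four variables, so the series has finite support and no
hypothesis on `ν₁`, `ν₂` is needed. The sums over `α` and `c` are divisor sums. -/
theorem hasSum_quadTerm_finiteSum {n₁ n₂ : ℤ} (hn₁ : n₁ ≠ 0) (hn₂ : n₂ ≠ 0) (ν₁ ν₂ : ℂ) :
    HasSum (quadTerm ν₁ ν₂ n₁ n₂) (finiteSum (1 - ν₁) (1 - ν₂) n₁.natAbs n₂.natAbs) := by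
  set n := n₁.natAbs with hn
  set m := n₂.natAbs with hm
  have hn0 : n ≠ 0 := Int.natAbs_ne_zero.2 hn₁
  have hm0 : m ≠ 0 := Int.natAbs_ne_zero.2 hn₂
  let S : Finset (Σ _ : (Σ _ : (Σ _ : ℕ, ℕ), ℕ), ℕ) :=
    ((n.divisors.sigma fun A => (m * A).divisors).sigma fun p =>
      (n * p.2 / p.1).divisors).sigma fun p => (m * Nat.gcd p.1.1 p.1.2 / p.1.2).divisors
  let t : (Σ _ : (Σ _ : (Σ _ : ℕ, ℕ), ℕ), ℕ) → ℂ := fun p =>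
    (p.1.1.1 : ℂ) ^ (2 - ν₁ - ν₂) * (p.1.1.2 : ℂ) ^ (1 - ν₂) * (p.1.2 : ℂ) ^ (1 - ν₁) *
      (p.2 : ℂ) ^ (3 - ν₁ - 2 * ν₂)
  let g : (Σ _ : (Σ _ : (Σ _ : ℕ, ℕ), ℕ), ℕ) → ℂ := fun p => if p ∈ S then t p else 0
  have h1 : HasSum g (∑ p ∈ S, g p) := hasSum_sum_of_ne_finset_zero fun d hd => if_neg hd
  have h2 : ∑ p ∈ S, g p = finiteSum (1 - ν₁) (1 - ν₂) n m := by
    rw [sum_congr rfl fun p hp => if_pos hp]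
    simp only [S, sum_sigma, t, finiteSum, sigmaNat]
    refine sum_congr rfl fun A _ => sum_congr rfl fun D _ => ?_
    rw [sum_mul_sum, mul_sum]
    refine sum_congr rfl fun α _ => ?_
    rw [mul_sum]
    refine sum_congr rfl fun c _ => ?_
    rw [show 1 - ν₂ + (1 - ν₁) = 2 - ν₁ - ν₂ by ring,
      show 2 - ν₁ - ν₂ + (1 - ν₂) = 3 - ν₁ - 2 * ν₂ by ring]
    ring
  rw [h2] at h1
  let j : ℕ+ × ℕ+ × ℕ+ × ℕ+ → (Σ _ : (Σ _ : (Σ _ : ℕ, ℕ), ℕ), ℕ) :=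
    fun q => ⟨⟨⟨q.2.1, q.2.2.1⟩, q.2.2.2⟩, q.1⟩
  have hj : Function.Injective j := by
    rintro ⟨c, A, D, α⟩ ⟨c', A', D', α'⟩ h
    simpa [j, and_assoc, and_comm, and_left_comm] using h
  rw [← hj.hasSum_iff] at h1
  · convert h1 using 1
    funext q
    obtain ⟨c, A, D, α⟩ := q
    have hmem : j (c, A, D, α) ∈ S ↔
        ((A * α / Nat.gcd α D : ℕ) : ℤ) ∣ n₁ ∧ ((D / Nat.gcd A D * c : ℕ) : ℤ) ∣ n₂ := by
      rw [Int.natCast_dvd, Int.natCast_dvd, ← hn, ← hm,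
        mul_div_gcd_dvd_iff A.ne_zero α.ne_zero, div_gcd_mul_dvd_iff D.ne_zero]
      simp only [S, j, mem_sigma, Nat.mem_divisors]
      constructor
      · rintro ⟨⟨⟨h1, h2⟩, h3⟩, h4⟩
        exact ⟨⟨h1.1, h3.1⟩, h2.1, h4.1⟩
      · rintro ⟨⟨h1, h3⟩, h2, h4⟩
        have hmA : m * A ≠ 0 := mul_ne_zero hm0 A.ne_zero
        have hD : (D : ℕ) ∣ m * Nat.gcd A D := by
          rw [← Nat.gcd_mul_left]
          exact Nat.dvd_gcd h2 (dvd_mul_left _ _)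
        refine ⟨⟨⟨⟨h1, hn0⟩, h2, hmA⟩, h3, ?_⟩, h4, ?_⟩
        · exact (Nat.div_pos (Nat.le_of_dvd (Nat.pos_of_ne_zero (mul_ne_zero hn0 D.ne_zero))
            (h1.mul_right _)) A.pos).ne'
        · exact (Nat.div_pos (Nat.le_of_dvd (Nat.pos_of_ne_zero (mul_ne_zero hm0
            (Nat.gcd_ne_zero_left A.ne_zero))) hD) D.pos).ne'
    simp only [Function.comp, g, hmem, quadTerm, t, j]
    by_cases c1 : ((A * α / Nat.gcd α D : ℕ) : ℤ) ∣ n₁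
    · by_cases c2 : ((D / Nat.gcd A D * c : ℕ) : ℤ) ∣ n₂
      · simp only [c1, c2, if_true, and_self]
        ring
      · simp only [c2, if_false, and_false, mul_zero]
    · simp only [c1, if_false, false_and, mul_zero, zero_mul]
  · rintro ⟨⟨⟨A, D⟩, α⟩, c⟩ hp
    refine if_neg fun h => hp ?_
    simp only [S, mem_sigma] at h
    exact ⟨(⟨c, Nat.pos_of_mem_divisors h.2⟩, ⟨A, Nat.pos_of_mem_divisors h.1.1.1⟩,
      ⟨D, Nat.pos_of_mem_divisors h.1.1.2⟩, ⟨α, Nat.pos_of_mem_divisors h.1.2⟩), rfl⟩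

theorem sum_divisors_mul_of_coprime {M : Type*} [AddCommMonoid M] {a b : ℕ} (h : Nat.Coprime a b)
    (f : ℕ → M) :
    ∑ d ∈ (a * b).divisors, f d = ∑ d₁ ∈ a.divisors, ∑ d₂ ∈ b.divisors, f (d₁ * d₂) := by
  rw [h.divisors_mul, sum_map]
  exact (sum_attach (a.divisors ×ˢ b.divisors) fun p => f (p.1 * p.2)).trans
    (sum_product _ _ _)

theorem sigmaNat_mul {a b : ℕ} (h : Nat.Coprime a b) (w : ℂ) :
    sigmaNat w (a * b) = sigmaNat w a * sigmaNat w b := by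
  simp only [sigmaNat, sum_divisors_mul_of_coprime h, sum_mul_sum, natCast_mul_cpow]

/-- The variables `A` and `D` divide `n n'` and `m m' A`, so they factor into parts supported on
coprime sets of primes, and gcds, quotients and divisor sums factor accordingly. -/
theorem finiteSum_mul {n m n' m' : ℕ} (h : Nat.Coprime (n * m) (n' * m')) (x s : ℂ) :
    finiteSum x s (n * n') (m * m') = finiteSum x s n m * finiteSum x s n' m' := by
  have hnn : Nat.Coprime n n' :=
    (h.coprime_dvd_left (dvd_mul_right _ _)).coprime_dvd_right (dvd_mul_right _ _)
  rw [finiteSum, sum_divisors_mul_of_coprime hnn]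
  have hL : ∀ A ∈ n.divisors, ∀ B ∈ n'.divisors,
      ∑ D ∈ (m * m' * (A * B)).divisors, ((A * B : ℕ) : ℂ) ^ (s + x) * (D : ℂ) ^ s *
        (sigmaNat x (n * n' * D / (A * B)) *
          sigmaNat (s + x + s) (m * m' * Nat.gcd (A * B) D / D)) =
      (∑ D ∈ (m * A).divisors, (A : ℂ) ^ (s + x) * (D : ℂ) ^ s *
        (sigmaNat x (n * D / A) * sigmaNat (s + x + s) (m * Nat.gcd A D / D))) *
      ∑ D ∈ (m' * B).divisors, (B : ℂ) ^ (s + x) * (D : ℂ) ^ s *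
        (sigmaNat x (n' * D / B) * sigmaNat (s + x + s) (m' * Nat.gcd B D / D)) := by
    intro A hA B hB
    have hA' := Nat.dvd_of_mem_divisors hA
    have hB' := Nat.dvd_of_mem_divisors hB
    have hmA : m * A ∣ n * m := by rw [mul_comm]; exact mul_dvd_mul_right hA' m
    have hmB : m' * B ∣ n' * m' := by rw [mul_comm]; exact mul_dvd_mul_right hB' m'
    have hc : Nat.Coprime (m * A) (m' * B) := (h.coprime_dvd_left hmA).coprime_dvd_right hmB
    rw [mul_mul_mul_comm, sum_divisors_mul_of_coprime hc, sum_mul_sum]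
    refine sum_congr rfl fun D hD => sum_congr rfl fun E hE => ?_
    have hD' := Nat.dvd_of_mem_divisors hD
    have hE' := Nat.dvd_of_mem_divisors hE
    have hDn := hD'.trans hmA
    have hEn := hE'.trans hmB
    have hAB : Nat.Coprime A B := (hnn.coprime_dvd_left hA').coprime_dvd_right hB'
    have hDE : Nat.Coprime D E := (h.coprime_dvd_left hDn).coprime_dvd_right hEn
    have hAE : Nat.Coprime A E := ((h.coprime_dvd_left (dvd_mul_right _ _)).coprime_dvd_left
      hA').coprime_dvd_right hEn
    have hBD : Nat.Coprime B D := ((h.symm.coprime_dvd_left (dvd_mul_right _ _)).coprime_dvd_left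
      hB').coprime_dvd_right hDn
    have hgcd : Nat.gcd (A * B) (D * E) = Nat.gcd A D * Nat.gcd B E := by
      rw [hDE.gcd_mul, hBD.gcd_mul_right_cancel, hAE.gcd_mul_left_cancel]
    have d1 : D ∣ m * Nat.gcd A D := by
      rw [← Nat.gcd_mul_left]
      exact Nat.dvd_gcd hD' (dvd_mul_left _ _)
    have d2 : E ∣ m' * Nat.gcd B E := by
      rw [← Nat.gcd_mul_left]
      exact Nat.dvd_gcd hE' (dvd_mul_left _ _)
    have e1 : n * n' * (D * E) / (A * B) = n * D / A * (n' * E / B) := by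
      rw [mul_mul_mul_comm]
      exact Nat.mul_div_mul_comm (hA'.mul_right _) (hB'.mul_right _)
    have e2 : m * m' * Nat.gcd (A * B) (D * E) / (D * E) =
        m * Nat.gcd A D / D * (m' * Nat.gcd B E / E) := by
      rw [hgcd, mul_mul_mul_comm]
      exact Nat.mul_div_mul_comm d1 d2
    have c1 : Nat.Coprime (n * D / A) (n' * E / B) := by
      refine Nat.Coprime.coprime_dvd_left (Nat.div_dvd_of_dvd (hA'.mul_right _))
        (Nat.Coprime.coprime_dvd_right (Nat.div_dvd_of_dvd (hB'.mul_right _)) ?_)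
      refine Nat.Coprime.mul_left (Nat.Coprime.mul_right hnn ?_) (Nat.Coprime.mul_right ?_ hDE)
      · exact (h.coprime_dvd_left (dvd_mul_right _ _)).coprime_dvd_right hEn
      · exact (h.coprime_dvd_left hDn).coprime_dvd_right (dvd_mul_right _ _)
    have c2 : Nat.Coprime (m * Nat.gcd A D / D) (m' * Nat.gcd B E / E) :=
      Nat.Coprime.coprime_dvd_left
        ((Nat.div_dvd_of_dvd d1).trans (mul_dvd_mul_left _ (Nat.gcd_dvd_left _ _)))
        (Nat.Coprime.coprime_dvd_right
          ((Nat.div_dvd_of_dvd d2).trans (mul_dvd_mul_left _ (Nat.gcd_dvd_left _ _))) hc)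
    rw [e1, e2, sigmaNat_mul c1, sigmaNat_mul c2, natCast_mul_cpow, natCast_mul_cpow]
    ring
  rw [sum_congr rfl fun A hA => sum_congr rfl fun B hB => hL A hA B hB, finiteSum, finiteSum,
    sum_mul_sum]

theorem finiteSum_prod {T : Finset ℕ} (hT : ∀ p ∈ T, p.Prime) (k l : ℕ → ℕ) (x s : ℂ) :
    finiteSum x s (∏ p ∈ T, p ^ k p) (∏ p ∈ T, p ^ l p) =
      ∏ p ∈ T, finiteSum x s (p ^ k p) (p ^ l p) := by
  induction T using Finset.induction_on with
  | empty => simp [finiteSum, sigmaNat]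
  | insert p T hp ih =>
    rw [prod_insert hp, prod_insert hp, prod_insert hp, finiteSum_mul, ih]
    · exact fun q hq => hT q (mem_insert_of_mem hq)
    · have hcop : ∀ u v : ℕ, ∀ k : ℕ → ℕ, Nat.Coprime (p ^ u) (∏ q ∈ T, q ^ k q) := by
        intro u _ k
        refine Nat.Coprime.prod_right fun q hq => Nat.Coprime.pow _ _ ?_
        rw [Nat.coprime_primes (hT p (mem_insert_self _ _)) (hT q (mem_insert_of_mem hq))]
        rintro rfl
        exact hp hq
      exact Nat.Coprime.mul_left (Nat.Coprime.mul_right (hcop _ 0 _) (hcop _ 0 _))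
        (Nat.Coprime.mul_right (hcop _ 0 _) (hcop _ 0 _))

theorem finiteSum_eq_prod {n m : ℕ} (hn : n ≠ 0) (hm : m ≠ 0) (x s : ℂ) :
    finiteSum x s n m = ∏ p ∈ (n * m).primeFactors,
      finiteSum x s (p ^ padicValNat p n) (p ^ padicValNat p m) := by
  have hprime : ∀ p ∈ (n * m).primeFactors, p.Prime := fun p hp => Nat.prime_of_mem_primeFactors hp
  rw [← finiteSum_prod hprime]
  have hfac : ∀ k : ℕ, k ≠ 0 → k ∣ n * m →
      ∏ p ∈ (n * m).primeFactors, p ^ padicValNat p k = k := by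
    intro k hk hkd
    conv_rhs => rw [← Nat.prod_factorization_pow_eq_self hk]
    rw [Finsupp.prod_of_support_subset (s := (n * m).primeFactors) _ _ _ (by simp)]
    · exact prod_congr rfl fun p hp => by rw [Nat.factorization_def _ (hprime p hp)]
    · rw [Nat.support_factorization]
      exact Nat.primeFactors_mono hkd (mul_ne_zero hn hm)
  rw [hfac n hn (dvd_mul_right _ _), hfac m hm (dvd_mul_left _ _)]

/-! ### Local factors and the symplectic Schur function -/

/-- The geometric sum `1 + X + ⋯ + X ^ n`. -/
def geomSum (X : ℂ) (n : ℕ) : ℂ := ∑ k ∈ range (n + 1), X ^ k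

theorem geomSum_mul (X : ℂ) (n : ℕ) : (X - 1) * geomSum X n = X ^ (n + 1) - 1 :=
  mul_geom_sum X (n + 1)

theorem geomSum_succ (X : ℂ) (n : ℕ) : geomSum X (n + 1) = X * geomSum X n + 1 := by
  rw [geomSum, sum_range_succ', geomSum, mul_sum]
  simp [pow_succ']

theorem natCast_pow_cpow (p k : ℕ) (w : ℂ) : ((p ^ k : ℕ) : ℂ) ^ w = ((p : ℂ) ^ w) ^ k := by
  rw [Nat.cast_pow, ← Complex.natCast_cpow_natCast_mul, Complex.cpow_nat_mul]

theorem sigmaNat_prime_pow {p : ℕ} (hp : p.Prime) (k : ℕ) (w : ℂ) :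
    sigmaNat w (p ^ k) = geomSum ((p : ℂ) ^ w) k := by
  rw [sigmaNat, Nat.sum_divisors_prime_pow hp]
  exact sum_congr rfl fun l _ => natCast_pow_cpow p l w

/-- The contribution to the local sum of the exponents `j < i`. -/
def lowerSum (X Y : ℂ) (n : ℕ) : ℂ :=
  ∑ i ∈ range (n + 1), ∑ j ∈ range i, (X * Y) ^ i * Y ^ j * geomSum X (n + j - i)

/-- The contribution to the local sum of the exponents `j = i + m`. -/
def upperSum (X Y : ℂ) (n k : ℕ) : ℂ :=
  ∑ m ∈ range (k + 1), Y ^ m * geomSum X (n + m) * geomSum (X * Y ^ 2) (k - m)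

/-- With `A = p ^ i` and `D = p ^ j`, the sum splits according to whether `gcd(A, D)` is `D` (`j <
i`) or `A` (`j = i + m`). In the first range the sum over `c` no longer depends on `i`, `j`. In the
second the monomial is `(X Y²) ^ i Y ^ m`, and the sum over `i` separates. -/
theorem finiteSum_prime_pow {p : ℕ} (hp : p.Prime) (x s : ℂ) (k l : ℕ) :
    finiteSum x s (p ^ k) (p ^ l) =
      geomSum ((p : ℂ) ^ x * ((p : ℂ) ^ s) ^ 2) l * lowerSum ((p : ℂ) ^ x) ((p : ℂ) ^ s) k +
      geomSum ((p : ℂ) ^ x * ((p : ℂ) ^ s) ^ 2) k *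
        upperSum ((p : ℂ) ^ x) ((p : ℂ) ^ s) k l := by
  have hp0 : (p : ℂ) ≠ 0 := by exact_mod_cast hp.ne_zero
  rw [finiteSum, Nat.sum_divisors_prime_pow hp, lowerSum]
  have hr : (p : ℂ) ^ (s + x) = (p : ℂ) ^ x * (p : ℂ) ^ s := by
    rw [Complex.cpow_add _ _ hp0, mul_comm]
  have hq : (p : ℂ) ^ (s + x + s) = (p : ℂ) ^ x * ((p : ℂ) ^ s) ^ 2 := by
    rw [Complex.cpow_add _ _ hp0, hr]
    ring
  set X := (p : ℂ) ^ x with hX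
  set Y := (p : ℂ) ^ s with hY
  set Q := X * Y ^ 2 with hQ
  have hgk : geomSum Q k = ∑ i ∈ range (k + 1), Q ^ i := rfl
  rw [mul_sum, hgk, sum_mul, ← sum_add_distrib]
  refine sum_congr rfl fun i hi => ?_
  have hik : i ≤ k := Nat.lt_succ_iff.1 (mem_range.1 hi)
  rw [← pow_add, Nat.sum_divisors_prime_pow hp, show l + i + 1 = i + (l + 1) by ring,
    sum_range_add, upperSum, mul_sum, mul_sum]
  congr 1
  · refine sum_congr rfl fun j hj => ?_
    have hji : j ≤ i := (mem_range.1 hj).le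
    rw [Nat.gcd_eq_right (pow_dvd_pow p hji), Nat.mul_div_cancel _ (pow_pos hp.pos j), ← pow_add,
      Nat.pow_div (by omega) hp.pos, sigmaNat_prime_pow hp, sigmaNat_prime_pow hp,
      natCast_pow_cpow, natCast_pow_cpow, hr, hq]
    ring
  · refine sum_congr rfl fun m hm => ?_
    have hml : m ≤ l := Nat.lt_succ_iff.1 (mem_range.1 hm)
    rw [Nat.gcd_eq_left (pow_dvd_pow p (Nat.le_add_right i m)), ← pow_add, ← pow_add,
      Nat.pow_div (by omega) hp.pos, Nat.pow_div (by omega) hp.pos, sigmaNat_prime_pow hp,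
      sigmaNat_prime_pow hp, natCast_pow_cpow, natCast_pow_cpow, hr, hq,
      show k + (i + m) - i = k + m by omega, show l + i - (i + m) = l - m by omega, hQ]
    ring

/-- Shifting `i` by one extracts `X Y`; the new diagonal terms `j = i` give the product of geometric
sums. -/
theorem lowerSum_succ (X Y : ℂ) (n : ℕ) :
    lowerSum X Y (n + 1) = X * Y * (lowerSum X Y n + geomSum X n * geomSum (X * Y ^ 2) n) := by
  have hg : geomSum (X * Y ^ 2) n = ∑ i ∈ range (n + 1), (X * Y ^ 2) ^ i := rfl
  rw [lowerSum, sum_range_succ', range_zero, sum_empty, add_zero, lowerSum, hg, mul_sum,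
    ← sum_add_distrib, mul_sum]
  refine sum_congr rfl fun i _ => ?_
  rw [sum_range_succ, mul_add, mul_sum]
  congr 1
  · refine sum_congr rfl fun j _ => ?_
    rw [show n + 1 + j - (i + 1) = n + j - i by omega]
    ring
  · rw [show n + 1 + i - (i + 1) = n by omega]
    ring

theorem lowerSum_eq (X Y : ℂ) (n : ℕ) :
    (X - 1) * (X * Y ^ 2 - 1) * (X * Y - 1) * (Y - 1) * lowerSum X Y n =
      (Y - 1) * ((X * Y) ^ (2 * n + 2) - X * Y) +
        (X * Y - 1) * (Y * X ^ (n + 1) - (X * Y ^ 2) ^ (n + 1)) := by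
  induction n with
  | zero =>
    simp only [lowerSum, zero_add, sum_range_one, range_zero, sum_empty]
    ring
  | succ n ih =>
    have h1 := geomSum_mul X n
    have h2 := geomSum_mul (X * Y ^ 2) n
    rw [lowerSum_succ]
    have h3 : (X - 1) * (X * Y ^ 2 - 1) * (geomSum X n * geomSum (X * Y ^ 2) n) =
        (X ^ (n + 1) - 1) * ((X * Y ^ 2) ^ (n + 1) - 1) := by
      rw [← h1, ← h2]
      ring
    linear_combination X * Y * ih + X * Y * (X * Y - 1) * (Y - 1) * h3

theorem sum_pow_mul_geomSum (X Y : ℂ) (n k : ℕ) :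
    (X - 1) * (X * Y - 1) * (Y - 1) * ∑ m ∈ range (k + 1), Y ^ m * geomSum X (n + m) =
      X ^ (n + 1) * (Y - 1) * ((X * Y) ^ (k + 1) - 1) - (X * Y - 1) * (Y ^ (k + 1) - 1) := by
  induction k with
  | zero =>
    have h := geomSum_mul X n
    simp only [zero_add, sum_range_one, add_zero]
    linear_combination (X * Y - 1) * (Y - 1) * h
  | succ k ih =>
    have h := geomSum_mul X (n + (k + 1))
    rw [sum_range_succ]
    linear_combination ih + (X * Y - 1) * (Y - 1) * Y ^ (k + 1) * h

/-- The recursion `geomSum Q (r + 1) = Q * geomSum Q r + 1` is applied to each inner factor, leaving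
a single sum evaluated by `sum_pow_mul_geomSum`. -/
theorem upperSum_succ (X Y : ℂ) (n k : ℕ) :
    upperSum X Y n (k + 1) = X * Y ^ 2 * upperSum X Y n k +
      ∑ m ∈ range (k + 2), Y ^ m * geomSum X (n + m) := by
  have h : ∑ m ∈ range (k + 1), Y ^ m * geomSum X (n + m) * geomSum (X * Y ^ 2) (k + 1 - m) =
      X * Y ^ 2 * upperSum X Y n k + ∑ m ∈ range (k + 1), Y ^ m * geomSum X (n + m) := by
    rw [upperSum, mul_sum, ← sum_add_distrib]
    refine sum_congr rfl fun m hm => ?_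
    rw [show k + 1 - m = k - m + 1 by have := mem_range.1 hm; omega, geomSum_succ]
    ring
  rw [upperSum, sum_range_succ, sum_range_succ (n := k + 1), h, Nat.sub_self,
    show geomSum (X * Y ^ 2) 0 = 1 by simp [geomSum]]
  ring

theorem upperSum_eq (X Y : ℂ) (n k : ℕ) :
    (X - 1) * (X * Y ^ 2 - 1) * (X * Y - 1) * (Y - 1) * upperSum X Y n k =
      (X * Y - 1) * (X ^ (n + 1) * X ^ (k + 1) * Y ^ (k + 2) + 1) * (Y ^ (k + 1) - 1) -
        (Y - 1) * (X ^ (n + 1) + X * Y ^ (k + 2)) * ((X * Y) ^ (k + 1) - 1) := by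
  induction k with
  | zero =>
    have h := geomSum_mul X n
    simp only [upperSum, zero_add, sum_range_one, add_zero, Nat.sub_zero]
    rw [show geomSum (X * Y ^ 2) 0 = 1 by simp [geomSum]]
    linear_combination (X * Y ^ 2 - 1) * (X * Y - 1) * (Y - 1) * h
  | succ k ih =>
    have h := sum_pow_mul_geomSum X Y n (k + 1)
    rw [upperSum_succ]
    linear_combination X * Y ^ 2 * ih + (X * Y ^ 2 - 1) * h

/-- The outer geometric sums in `X Y²` bring in a second factor `X Y² - 1`, which is cancelled at
the end; this is the one place that needs `X Y² ≠ 1`. The right side is the Weyl numerator cleared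
of negative powers. -/
theorem localSum_eq {X Y : ℂ} (hQ : X * Y ^ 2 ≠ 1) (n k : ℕ) :
    (X - 1) * (X * Y ^ 2 - 1) * (X * Y - 1) * (Y - 1) *
      (geomSum (X * Y ^ 2) k * lowerSum X Y n + geomSum (X * Y ^ 2) n * upperSum X Y n k) =
      ((X * Y ^ 2) ^ (n + k + 2) - 1) * (X ^ (n + 1) - 1) -
        Y ^ (k + 1) * (X ^ (n + k + 2) - 1) * ((X * Y ^ 2) ^ (n + 1) - 1) := by
  refine mul_left_cancel₀ (sub_ne_zero.2 hQ) ?_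
  have h1 := geomSum_mul (X * Y ^ 2) k
  have h2 := geomSum_mul (X * Y ^ 2) n
  have h3 := lowerSum_eq X Y n
  have h4 := upperSum_eq X Y n k
  linear_combination ((X * Y ^ 2) ^ (k + 1) - 1) * h3 + ((X * Y ^ 2) ^ (n + 1) - 1) * h4 +
    (X - 1) * (X * Y ^ 2 - 1) * (X * Y - 1) * (Y - 1) * (lowerSum X Y n * h1 +
      upperSum X Y n k * h2)

/-- One formula clears the negative powers in both determinants, the Weyl denominator being the case
`n = k = 0`, which moreover factors. A vanishing denominator needs no exclusion, since both
quotients then have the value `0`. -/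
theorem symplecticSchur_eq {b Y : ℂ} (hb : b ≠ 0) (hY : Y ≠ 0) (n k : ℕ) :
    (b * Y) ^ (n + k) * b ^ n * symplecticSchur (n + k) n (b * Y) b =
      (((b ^ 2 * Y ^ 2) ^ (n + k + 2) - 1) * ((b ^ 2) ^ (n + 1) - 1) -
        Y ^ (k + 1) * ((b ^ 2) ^ (n + k + 2) - 1) * ((b ^ 2 * Y ^ 2) ^ (n + 1) - 1)) /
      ((b ^ 2 - 1) * (b ^ 2 * Y ^ 2 - 1) * (b ^ 2 * Y - 1) * (Y - 1)) := by
  have hdet : ∀ m l : ℕ, (b * Y) ^ (m + l + 2) * b ^ (m + 1) *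
      Matrix.det !![(b * Y) ^ (m + l + 2) - ((b * Y) ^ (m + l + 2))⁻¹,
        b ^ (m + l + 2) - (b ^ (m + l + 2))⁻¹;
        (b * Y) ^ (m + 1) - ((b * Y) ^ (m + 1))⁻¹, b ^ (m + 1) - (b ^ (m + 1))⁻¹] =
      ((b ^ 2 * Y ^ 2) ^ (m + l + 2) - 1) * ((b ^ 2) ^ (m + 1) - 1) -
        Y ^ (l + 1) * ((b ^ 2) ^ (m + l + 2) - 1) * ((b ^ 2 * Y ^ 2) ^ (m + 1) - 1) := by
    intro m l
    rw [Matrix.det_fin_two_of]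
    have hP : ∀ i : ℕ, (b * Y) ^ i * ((b * Y) ^ i)⁻¹ = 1 := fun i =>
      mul_inv_cancel₀ (pow_ne_zero _ (mul_ne_zero hb hY))
    have hR : ∀ i : ℕ, b ^ i * (b ^ i)⁻¹ = 1 := fun i => mul_inv_cancel₀ (pow_ne_zero _ hb)
    have e1 : (b * Y) ^ (m + l + 2) * b ^ (m + 1) =
        Y ^ (l + 1) * (b ^ (m + l + 2) * (b * Y) ^ (m + 1)) := by ring
    have e2 : ∀ u v : ℂ, u * v = 1 → u * (u - v) = u ^ 2 - 1 := fun u v h => by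
      linear_combination -h
    rw [mul_sub]
    congr 1
    · calc _ = ((b * Y) ^ (m + l + 2) * ((b * Y) ^ (m + l + 2) - ((b * Y) ^ (m + l + 2))⁻¹)) *
          (b ^ (m + 1) * (b ^ (m + 1) - (b ^ (m + 1))⁻¹)) := by ring
        _ = _ := by
          rw [e2 _ _ (hP _), e2 _ _ (hR _)]
          ring
    · rw [e1]
      calc _ = Y ^ (l + 1) * (b ^ (m + l + 2) * (b ^ (m + l + 2) - (b ^ (m + l + 2))⁻¹)) *
          ((b * Y) ^ (m + 1) * ((b * Y) ^ (m + 1) - ((b * Y) ^ (m + 1))⁻¹)) := by ring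
        _ = _ := by
          rw [e2 _ _ (hP _), e2 _ _ (hR _)]
          ring
  have h0 := hdet 0 0
  have h1 := hdet n k
  simp only [zero_add, pow_one, add_zero] at h0
  have hc : (b * Y) ^ 2 * b ≠ 0 := mul_ne_zero (pow_ne_zero _ (mul_ne_zero hb hY)) hb
  rw [symplecticSchur, ← h1, show (b ^ 2 - 1) * (b ^ 2 * Y ^ 2 - 1) * (b ^ 2 * Y - 1) * (Y - 1) =
    ((b ^ 2 * Y ^ 2) ^ 2 - 1) * (b ^ 2 - 1) - Y * ((b ^ 2) ^ 2 - 1) * (b ^ 2 * Y ^ 2 - 1) by ring,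
    ← h0, ← mul_div_assoc, ← mul_div_mul_left _ _ hc]
  congr 1
  ring

theorem natCast_cpow_ne_one {p : ℕ} (hp : p.Prime) {w : ℂ} (hw : w.re < 0) : (p : ℂ) ^ w ≠ 1 := by
  intro h
  have h1 := Complex.norm_natCast_cpow_of_pos hp.pos w
  rw [h, norm_one] at h1
  exact (Real.rpow_lt_one_of_one_lt_of_neg (by exact_mod_cast hp.one_lt) hw).ne h1.symm

theorem finiteSum_prime_pow_eq_sigmaLocal {p : ℕ} (hp : p.Prime) {ν₁ ν₂ : ℂ} (h₁ : 1 < ν₁.re)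
    (h₂ : 1 < ν₂.re) (k l : ℕ) :
    finiteSum (1 - ν₁) (1 - ν₂) (p ^ k) (p ^ l) =
      sigmaLocal (3 / 2 - ν₁ / 2 - ν₂) (1 / 2 - ν₁ / 2) p k l := by
  have hp0 : (p : ℂ) ≠ 0 := by exact_mod_cast hp.ne_zero
  have hX : (p : ℂ) ^ (1 - ν₁) = ((p : ℂ) ^ (1 / 2 - ν₁ / 2)) ^ 2 := by
    rw [← Complex.cpow_nat_mul]
    congr 1
    push_cast
    ring
  have ha : (p : ℂ) ^ (3 / 2 - ν₁ / 2 - ν₂) =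
      (p : ℂ) ^ (1 / 2 - ν₁ / 2) * (p : ℂ) ^ (1 - ν₂) := by
    rw [← Complex.cpow_add _ _ hp0]
    congr 1
    ring
  -- With `X = p ^ (1 - ν₁)` and `Y = p ^ (1 - ν₂)`, the numbers `X`, `Y`, `X Y`, `X Y²` have
  -- modulus less than `1`, so the four factors of the Weyl denominator are nonzero.
  have n1 := natCast_cpow_ne_one hp (w := 1 - ν₁) (by simp; linarith)
  have n2 := natCast_cpow_ne_one hp (w := 1 - ν₂) (by simp; linarith)
  have n3 := natCast_cpow_ne_one hp (w := 1 - ν₁ + (1 - ν₂)) (by simp; linarith)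
  have n4 := natCast_cpow_ne_one hp (w := 1 - ν₁ + (1 - ν₂) + (1 - ν₂)) (by simp; linarith)
  rw [Complex.cpow_add _ _ hp0] at n3
  rw [Complex.cpow_add _ _ hp0, Complex.cpow_add _ _ hp0, mul_assoc, ← pow_two] at n4
  rw [finiteSum_prime_pow hp, sigmaLocal, Complex.cpow_add _ _ hp0]
  rw [show ((k : ℂ) + l) * (3 / 2 - ν₁ / 2 - ν₂) = ((k + l : ℕ) : ℂ) * (3 / 2 - ν₁ / 2 - ν₂) by
    push_cast; ring, Complex.cpow_nat_mul, Complex.cpow_nat_mul, ha,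
    symplecticSchur_eq (by simp [Complex.cpow_eq_zero_iff, hp0])
      (by simp [Complex.cpow_eq_zero_iff, hp0]), ← hX, ← localSum_eq n4, mul_div_cancel_left₀]
  exact mul_ne_zero (mul_ne_zero (mul_ne_zero (sub_ne_zero.2 n1) (sub_ne_zero.2 n4))
    (sub_ne_zero.2 n3)) (sub_ne_zero.2 n2)

theorem finiteSum_eq_sigmaTwo {n₁ n₂ : ℤ} (hn₁ : n₁ ≠ 0) (hn₂ : n₂ ≠ 0) {ν₁ ν₂ : ℂ}
    (h₁ : 1 < ν₁.re) (h₂ : 1 < ν₂.re) :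
    finiteSum (1 - ν₁) (1 - ν₂) n₁.natAbs n₂.natAbs =
      sigmaTwo (3 / 2 - ν₁ / 2 - ν₂) (1 / 2 - ν₁ / 2) n₁ n₂ := by
  rw [finiteSum_eq_prod (Int.natAbs_ne_zero.2 hn₁) (Int.natAbs_ne_zero.2 hn₂), sigmaTwo,
    Int.natAbs_mul]
  exact prod_congr rfl fun p hp =>
    finiteSum_prime_pow_eq_sigmaLocal (Nat.prime_of_mem_primeFactors hp) h₁ h₂ _ _

end

end SpRamanujan

theorem mainTheorem5 (ν₁ ν₂ : ℂ) (n₁ n₂ : ℤ) :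
    (n₁ ≠ 0 → n₂ ≠ 0 → 1 < ν₁.re → 1 < ν₂.re →
      Summable (SpRamanujan.dirichletTerm ν₁ ν₂ n₁ n₂) ∧
      SpRamanujan.ramanujan ν₁ ν₂ n₁ n₂ =
        SpRamanujan.sigmaTwo (3 / 2 - ν₁ / 2 - ν₂) (1 / 2 - ν₁ / 2) n₁ n₂ /
          SpRamanujan.zetaDenom ν₁ ν₂) ∧
    (n₁ ≠ 0 → n₂ = 0 → 1 < ν₁.re → 2 < ν₂.re →
      Summable (SpRamanujan.dirichletTerm ν₁ ν₂ n₁ n₂) ∧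
      SpRamanujan.ramanujan ν₁ ν₂ n₁ n₂ =
        SpRamanujan.sigmaOne (1 - ν₁) n₁ * riemannZeta (ν₂ - 1) * riemannZeta (ν₁ + ν₂ - 2) *
          riemannZeta (ν₁ + 2 * ν₂ - 3) / SpRamanujan.zetaDenom ν₁ ν₂) ∧
    (n₁ = 0 → n₂ ≠ 0 → 2 < ν₁.re → 1 < ν₂.re →
      Summable (SpRamanujan.dirichletTerm ν₁ ν₂ n₁ n₂) ∧
      SpRamanujan.ramanujan ν₁ ν₂ n₁ n₂ =
        SpRamanujan.sigmaOne (1 - ν₂) n₂ * riemannZeta (ν₁ - 1) * riemannZeta (ν₁ + ν₂ - 2) *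
          riemannZeta (ν₁ + 2 * ν₂ - 3) / SpRamanujan.zetaDenom ν₁ ν₂) ∧
    (n₁ = 0 → n₂ = 0 → 2 < ν₁.re → 2 < ν₂.re →
      Summable (SpRamanujan.dirichletTerm ν₁ ν₂ n₁ n₂) ∧
      SpRamanujan.ramanujan ν₁ ν₂ n₁ n₂ =
        riemannZeta (ν₁ - 1) * riemannZeta (ν₂ - 1) * riemannZeta (ν₁ + ν₂ - 2) *
          riemannZeta (ν₁ + 2 * ν₂ - 3) / SpRamanujan.zetaDenom ν₁ ν₂) := by
  refine ⟨fun hn₁ hn₂ h₁ h₂ => ?_, fun hn₁ hn₂ h₁ h₂ => ?_, fun hn₁ hn₂ h₁ h₂ => ?_,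
    fun hn₁ hn₂ h₁ h₂ => ?_⟩
  · rw [← SpRamanujan.finiteSum_eq_sigmaTwo hn₁ hn₂ h₁ h₂]
    exact SpRamanujan.summable_and_tsum_expSum h₁ h₂
      (SpRamanujan.hasSum_quadTerm_finiteSum hn₁ hn₂ ν₁ ν₂)
  · subst hn₂
    exact SpRamanujan.summable_and_tsum_expSum h₁ (by linarith)
      (SpRamanujan.hasSum_quadTerm_left hn₁ h₁ h₂)
  · subst hn₁
    exact SpRamanujan.summable_and_tsum_expSum (by linarith) h₂
      (SpRamanujan.hasSum_quadTerm_right hn₂ h₁ h₂)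
  · subst hn₁ hn₂
    exact SpRamanujan.summable_and_tsum_expSum (by linarith) (by linarith)
      (SpRamanujan.hasSum_quadTerm_zero_zero h₁ h₂)
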